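/- **Notation.** Functions take values in $\mathbb R\cup\{+\infty\}$, and $\operatorname{dom} g=\{x: g(x)<+\infty\}$. For $x\in\operatorname{dom} g$, the Fréchet subdifferential $\widehat\partial g(x)$ is the set of $v$ with $g(z)\ge g(x)+\langle v,z-x\rangle-o(\|z-x\|)$ as $z\to x$. The limiting subdifferential $\partial g(x)$ is the set of limits of $v_k\in\widehat\partial g(y_k)$ with $y_k\to x$, $g(y_k)\to g(x)$. The horizon subdifferential $\partial^\infty g(x)$ is the set of limits of $t_kv_k$ with such $v_k,y_k$ and $t_k>0$, $t_k\to0$. All three are empty off $\operatorname{dom} g$, and $\|\partial g(x)\|_-:=\inf_{v\in\partial g(x)}\|v\|$ ($=+\infty$ if $\partial g(x)=\emptyset$). $N_C(x)$ is the limiting normal cone of $C$ at $x\in C$. A function is *regular* at a point where it is finite if its epigraph is Clarke regular (locally closed, with all normals Fréchet normals) at the corresponding point. $\mathbb R^N\times\mathbb R^N$ carries the Euclidean structure. **Setting.** Let $f:\mathbb R^N\to\mathbb R\cup\{+\infty\}$ be proper, lower semicontinuous (lsc) and coercive ($f(x)\to\infty$ as $\|x\|\to\infty$). Let $h$ be a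 Legendre function on $\mathbb R^N$ (proper, lsc, convex, essentially smooth, essentially strictly convex) that is $C^2$ on $\operatorname{int}\operatorname{dom} h$, with Bregman distance $D_h(x,y)=h(x)-h(y)-\langle\nabla h(y),x-y\rangle$ for $y\in\operatorname{int}\operatorname{dom} h$, and $D_h(x,y)=+\infty$ for other $y$. Assume $\operatorname{dom} f\subset\overline{\operatorname{dom} h}$, $\operatorname{dom} f\cap\operatorname{int}\operatorname{dom} h\ne\emptyset$, and $0\in\partial f(x)$ for some $x\in\operatorname{int}\operatorname{dom} h$. Let $f(\cdot;\cdot):\mathbb R^N\times\mathbb R^N\to\mathbb R\cup\{+\infty\}$, let $\bar L>0$, $\underline L\in\mathbb R$, and assume: 1. $f(\cdot;\cdot)$ is proper and lsc, $f(x;y)=+\infty$ whenever $x\notin\operatorname{dom} f$, $f(x;y)<+\infty$ on $\operatorname{dom} f\times\operatorname{dom} f$, and $f(\cdot;\cdot)$ is continuous on $\operatorname{dom} f\times\operatorname{dom} f$. 2. For every $y\in\operatorname{dom} f\cap\operatorname{int}\operatorname{dom} h$, $f(\cdot;y)$ is a model function for $f$ around $y$: there is a differentiable $\omega_y:[0,\infty)\to[0,\infty)$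 with $\omega_y(0)=\omega_y'(0^+)=0$ and $|f(x)-f(x;y)|\le\omega_y(\|x-y\|)$ for all $x\in\operatorname{dom} f$; and $$-\underline L\,D_h(x,y)\le f(x)-f(x;y)\le\bar L\,D_h(x,y)\qquad\text{for all }x\in\operatorname{dom} f\cap\operatorname{dom} h .$$ 3. $\partial^\infty_x f(x;y)\cap(-N_{\operatorname{dom} h}(x))=\{0\}$ for all $y\in\operatorname{dom} f\cap\operatorname{int}\operatorname{dom} h$, $x\in\operatorname{dom} f\cap\operatorname{dom} h$. 4. Either (a) for all $x,y\in\operatorname{dom} f$: $(0,v)\in\partial^\infty f(x;y)$ implies $v=0$, $(v,0)\in\partial^\infty f(x;y)$ implies $v=0$, and $f(\cdot;\cdot)$ is regular at $(x,y)$; or (b) for all $x,y\in\operatorname{dom} f$: $\partial f(x;y)=\partial_xf(x;y)\times\partial_yf(x;y)$ and $\partial^\infty f(x;y)=\partial^\infty_xf(x;y)\times\partial^\infty_yf(x;y)$. 5. For every bounded $B\subset\operatorname{dom} f$ there is $c_B>0$ with $\inf_{v\in\partial_yf(x;y)}\|v\|\le c_B\|x-y\|$ for all $x,y\in B$. 6.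 For every compact convex $B\subset\operatorname{int}\operatorname{dom} h$ there is $\sigma_B>0$ with $D_h(x,y)\ge\frac{\sigma_B}2\|x-y\|^2$ for all $x,y\in B$. **Algorithm (Model BPG).** Let $0<\underline\tau<\bar\tau<1/\bar L$, $x_0=x_1\in\operatorname{dom} f\cap\operatorname{int}\operatorname{dom} h$, and for each $k\ge1$ let $\tau_k\in[\underline\tau,\bar\tau]$ and $$x_{k+1}\in\operatorname*{Argmin}_{x\in\mathbb R^N}\Big\{f(x;x_k)+\tfrac1{\tau_k}D_h(x,x_k)\Big\}.$$ **Theorem (convergence rates).** Suppose that $(x_k)$ converges to some $\bar x\in\operatorname{dom} f\cap\operatorname{int}\operatorname{dom} h$ and that the Lyapunov function $F(x,y)=f(x;y)+\bar L\,D_h(x,y)$ has the Kurdyka–Łojasiewicz property at $(\bar x,\bar x)$ with desingularizing function $\varphi(s)=c\,s^{1-\theta}$ for some $c>0$, $\theta\in[0,1)$; that is, there are $\eta\in(0,\infty]$ and a neighbourhood $U$ of $(\bar x,\bar x)$ with $\varphi'\big(F(z)-F(\bar x,\bar x)\big)\,\|\partial F(z)\|_-\ge1$ for all $z\in U$ such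 that $F(\bar x,\bar x)<F(z)<F(\bar x,\bar x)+\eta$. Then: - If $\theta=0$, then $(x_k)$ converges in finitely many steps: there is $K$ with $x_k=\bar x$ for all $k\ge K$. - If $\theta\in(0,\frac12]$, then there are $\rho\in[0,1)$ and $G>0$ with $\|x_k-\bar x\|\le G\rho^k$ for all $k\ge0$. - If $\theta\in(\frac12,1)$, then there is $G>0$ with $\|x_k-\bar x\|\le G\,k^{-\frac{1-\theta}{2\theta-1}}$ for all $k\ge1$. -/

import Mathlib

open Filter Topology Set

noncomputable section

namespace ModelBPG

section Subdifferentials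

variable {V : Type*} [NormedAddCommGroup V] [InnerProductSpace ℝ V]

/-- Effective domain of an extended-valued function. -/
def edom {X : Type*} (f : X → EReal) : Set X := {x | f x < ⊤}

/-- `f` takes values in `ℝ ∪ {+∞}` and is not identically `+∞`. -/
def IsProper {X : Type*} (f : X → EReal) : Prop :=
  (∀ x, f x ≠ ⊥) ∧ (edom f).Nonempty

/-- Fréchet subdifferential:
`f z ≥ f x + ⟨v, z - x⟩ - o(‖z - x‖)` as `z → x`, for `x ∈ dom f`; empty off `dom f`. -/
def frechetSubdiff (f : V → EReal) (x : V) : Set V :=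
  {v | x ∈ edom f ∧ ∀ ε : ℝ, 0 < ε → ∀ᶠ z in 𝓝 x,
    f x + ((inner ℝ v (z - x) - ε * ‖z - x‖ : ℝ) : EReal) ≤ f z}

/-- Limiting subdifferential; empty off `dom f`. -/
def limSubdiff (f : V → EReal) (x : V) : Set V :=
  {v | x ∈ edom f ∧ ∃ y w : ℕ → V,
    Tendsto y atTop (𝓝 x) ∧ Tendsto (fun k => f (y k)) atTop (𝓝 (f x)) ∧
    (∀ k, w k ∈ frechetSubdiff f (y k)) ∧ Tendsto w atTop (𝓝 v)}

/-- Horizon subdifferential; empty off `dom f`. -/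
def horizonSubdiff (f : V → EReal) (x : V) : Set V :=
  {v | x ∈ edom f ∧ ∃ (y w : ℕ → V) (t : ℕ → ℝ),
    Tendsto y atTop (𝓝 x) ∧ Tendsto (fun k => f (y k)) atTop (𝓝 (f x)) ∧
    (∀ k, w k ∈ frechetSubdiff f (y k)) ∧
    (∀ k, 0 < t k) ∧ Tendsto t atTop (𝓝 0) ∧ Tendsto (fun k => t k • w k) atTop (𝓝 v)}

/-- `inf { ‖v‖ : v ∈ ∂f(x) }`, which is `+∞` if `∂f(x)` is empty. -/
def subdiffNorm (f : V → EReal) (x : V) : ENNReal := ⨅ v ∈ limSubdiff f x, ‖v‖ₑ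

/-- Critical points of `f`. -/
def crit (f : V → EReal) : Set V := {x | (0 : V) ∈ limSubdiff f x}

/-- Regular (Fréchet) normals to `C` at `x`. -/
def frechetNormalCone (C : Set V) (x : V) : Set V :=
  {v | x ∈ C ∧ ∀ ε : ℝ, 0 < ε → ∀ᶠ z in 𝓝[C] x, inner ℝ v (z - x) ≤ ε * ‖z - x‖}

/-- (Limiting) normal cone to `C` at `x`. -/
def normalCone (C : Set V) (x : V) : Set V :=
  {v | x ∈ C ∧ ∃ y w : ℕ → V,
    Tendsto y atTop (𝓝 x) ∧ (∀ k, w k ∈ frechetNormalCone C (y k)) ∧ Tendsto w atTop (𝓝 v)}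

/-- Clarke regularity of a set at one of its points: the set is locally closed there and every
normal is a regular normal. -/
def ClarkeRegularAt (C : Set V) (x : V) : Prop :=
  x ∈ C ∧ (∃ r : ℝ, 0 < r ∧ IsClosed (C ∩ Metric.closedBall x r)) ∧
    normalCone C x = frechetNormalCone C x

/-- Epigraph of `f`, as a subset of the Euclidean product `V × ℝ`. -/
def epigraph (f : V → EReal) : Set (WithLp 2 (V × ℝ)) := {p | f p.fst ≤ (p.snd : EReal)}

/-- Subdifferential regularity of `f` at `x`: `f x` is finite and the epigraph of `f` is Clarke
regular at `(x, f x)`. -/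
def IsRegularAt (f : V → EReal) (x : V) : Prop :=
  f x ≠ ⊤ ∧ f x ≠ ⊥ ∧ ClarkeRegularAt (epigraph f) (WithLp.toLp 2 (x, (f x).toReal))

/-- `φ` is a desingularizing function on `[0, η)`, where `η ∈ (0, +∞]`. -/
structure IsDesingularizing (φ : ℝ → ℝ) (η : EReal) : Prop where
  nonneg : ∀ s : ℝ, 0 ≤ s → (s : EReal) < η → 0 ≤ φ s
  continuousOn : ContinuousOn φ {s : ℝ | 0 ≤ s ∧ (s : EReal) < η}
  concaveOn : ConcaveOn ℝ {s : ℝ | 0 ≤ s ∧ (s : EReal) < η} φ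
  map_zero : φ 0 = 0
  contDiffOn : ContDiffOn ℝ 1 φ {s : ℝ | 0 < s ∧ (s : EReal) < η}
  deriv_pos : ∀ s : ℝ, 0 < s → (s : EReal) < η → 0 < deriv φ s

/-- `F` has the Kurdyka–Łojasiewicz property at `x` with desingularizing function `φ`. -/
def HasKLPropertyAt (F : V → EReal) (x : V) (φ : ℝ → ℝ) : Prop :=
  ∃ η : EReal, 0 < η ∧ IsDesingularizing φ η ∧ ∃ U ∈ 𝓝 x, ∀ y ∈ U, F x < F y → F y < F x + η →
    1 ≤ ENNReal.ofReal (deriv φ ((F y).toReal - (F x).toReal)) * subdiffNorm F y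

end Subdifferentials

/-- The Euclidean space `ℝ^N`. -/
abbrev Euc (N : ℕ) : Type := EuclideanSpace ℝ (Fin N)

/-- The product `ℝ^N × ℝ^N` with its Euclidean structure. -/
abbrev Euc2 (N : ℕ) : Type := WithLp 2 (Euc N × Euc N)

variable {N : ℕ}

/-- A function of two variables as a function on the Euclidean product. -/
def joint (m : Euc N → Euc N → EReal) (z : Euc2 N) : EReal := m z.fst z.snd

/-- Domain of the convex subdifferential. -/
def domConvexSubdiff (h : Euc N → EReal) : Set (Euc N) :=
  {x | x ∈ edom h ∧ ∃ v : Euc N, ∀ z, h x + ((inner ℝ v (z - x) : ℝ) : EReal) ≤ h z}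

/-- The gradient of `h`; meaningful on the interior of `dom h`. -/
def grad (h : Euc N → EReal) (y : Euc N) : Euc N := gradient (fun z => (h z).toReal) y

/-- Legendre functions: proper, lower semicontinuous and convex, essentially smooth and
essentially strictly convex. -/
structure IsLegendre (h : Euc N → EReal) : Prop where
  proper : IsProper h
  lsc : LowerSemicontinuous h
  convexOn : ConvexOn ℝ (edom h) (fun x => (h x).toReal)
  interior_nonempty : (interior (edom h)).Nonempty
  differentiableOn : DifferentiableOn ℝ (fun x => (h x).toReal) (interior (edom h))
  steep : ∀ x ∈ frontier (edom h),
    Tendsto (fun y => ‖grad h y‖) (𝓝[interior (edom h)] x) atTop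
  strictConvexOn : ∀ C ⊆ domConvexSubdiff h, Convex ℝ C →
    StrictConvexOn ℝ C (fun x => (h x).toReal)

open Classical in
/-- Bregman distance `h x - h y - ⟨∇h(y), x - y⟩` for `y ∈ int dom h` (it is `+∞` for
`x ∉ dom h`), and `+∞` for `y ∉ int dom h`. -/
def bregman (h : Euc N → EReal) (x y : Euc N) : EReal :=
  if y ∈ interior (edom h) then
    h x - (((h y).toReal + inner ℝ (grad h y) (x - y) : ℝ) : EReal)
  else ⊤

/-- Growth functions `ω : [0, ∞) → [0, ∞)`. -/
structure IsGrowthFunction (ω : ℝ → ℝ) : Prop where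
  nonneg : ∀ t, 0 ≤ t → 0 ≤ ω t
  differentiableOn : DifferentiableOn ℝ ω (Ici 0)
  map_zero : ω 0 = 0
  deriv_zero : HasDerivWithinAt ω 0 (Ici 0) 0

/-- `g` is a model function for `f` around the model centre `y`. -/
def IsModelFunction (f g : Euc N → EReal) (y : Euc N) : Prop :=
  edom g = edom f ∧ ∃ ω : ℝ → ℝ, IsGrowthFunction ω ∧
    ∀ x ∈ edom f, |(f x).toReal - (g x).toReal| ≤ ω ‖x - y‖

/-- Model approximation property at `y` of `f` and the model `g` around `y`. All values compared
are finite. -/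
def HasMAP (f g h : Euc N → EReal) (Lu Ll : ℝ) (y : Euc N) : Prop :=
  ∀ x ∈ edom f ∩ edom h,
    -Ll * (bregman h x y).toReal ≤ (f x).toReal - (g x).toReal ∧
    (f x).toReal - (g x).toReal ≤ Lu * (bregman h x y).toReal

/-- Assumptions on the objective. -/
structure ObjectiveAssumption (f : Euc N → EReal) : Prop where
  proper : IsProper f
  lsc : LowerSemicontinuous f
  coercive : Tendsto f (Bornology.cobounded (Euc N)) (𝓝 ⊤)

/-- Horizon condition and regularity of `(x, y) ↦ m x y` on `dom f × dom f`. -/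
def HorizonAndRegular (f : Euc N → EReal) (m : Euc N → Euc N → EReal) : Prop :=
  ∀ x ∈ edom f, ∀ y ∈ edom f,
    (∀ v : Euc N, WithLp.toLp 2 (0, v) ∈ horizonSubdiff (joint m) (WithLp.toLp 2 (x, y)) → v = 0) ∧
    (∀ v : Euc N, WithLp.toLp 2 (v, 0) ∈ horizonSubdiff (joint m) (WithLp.toLp 2 (x, y)) → v = 0) ∧
    IsRegularAt (joint m) (WithLp.toLp 2 (x, y))

/-- On `dom f × dom f` the joint (horizon) subdifferential of `m` is the product of the partial
(horizon) subdifferentials. -/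
def SeparableSubdiff (f : Euc N → EReal) (m : Euc N → Euc N → EReal) : Prop :=
  ∀ x ∈ edom f, ∀ y ∈ edom f,
    limSubdiff (joint m) (WithLp.toLp 2 (x, y)) =
      {w | w.fst ∈ limSubdiff (fun x' => m x' y) x ∧ w.snd ∈ limSubdiff (m x) y} ∧
    horizonSubdiff (joint m) (WithLp.toLp 2 (x, y)) =
      {w | w.fst ∈ horizonSubdiff (fun x' => m x' y) x ∧ w.snd ∈ horizonSubdiff (m x) y}

/-- Assumptions on the Legendre function `h` and on the model `m`, where `m x y` is the value at
`x` of the model around `y`. -/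
structure ModelAssumption (f h : Euc N → EReal) (m : Euc N → Euc N → EReal) (Lu Ll : ℝ) :
    Prop where
  legendre : IsLegendre h
  contDiffOn : ContDiffOn ℝ 2 (fun x => (h x).toReal) (interior (edom h))
  dom_inter : (edom f ∩ interior (edom h)).Nonempty
  crit_inter : (crit f ∩ interior (edom h)).Nonempty
  dom_subset : edom f ⊆ closure (edom h)
  Lu_pos : 0 < Lu
  model : ∀ y ∈ edom f ∩ interior (edom h), IsModelFunction f (fun x => m x y) y
  map : ∀ y ∈ edom f ∩ interior (edom h), HasMAP f (fun x => m x y) h Lu Ll y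
  qualification : ∀ y ∈ edom f ∩ interior (edom h), ∀ x ∈ edom f ∩ edom h,
    horizonSubdiff (fun x' => m x' y) x ∩ {v | -v ∈ normalCone (edom h) x} = {0}
  joint_subdiff : HorizonAndRegular f m ∨ SeparableSubdiff f m
  joint_proper : IsProper (joint m)
  joint_dom : ∀ y ∈ edom f, edom (fun x => m x y) = edom f
  joint_dom_subset : ∀ x y, m x y < ⊤ → x ∈ edom f
  joint_lsc : LowerSemicontinuous (joint m)
  joint_cont : ContinuousOn (joint m) {z | z.fst ∈ edom f ∧ z.snd ∈ edom f}

/-- Variation of the model with respect to the model centre: on every bounded subset of `dom f`,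
the partial subdifferential in the centre has an element of norm `O(‖x - y‖)`. -/
def RelativeErrorAssumption (f : Euc N → EReal) (m : Euc N → Euc N → EReal) : Prop :=
  ∀ B ⊆ edom f, Bornology.IsBounded B → ∃ c : ℝ, 0 < c ∧ ∀ x ∈ B, ∀ y ∈ B,
    subdiffNorm (m x) y ≤ ENNReal.ofReal (c * ‖x - y‖)

/-- `h` is strongly convex on every compact convex subset of the interior of its domain. -/
def LocalStrongConvexity (h : Euc N → EReal) : Prop :=
  ∀ B ⊆ interior (edom h), IsCompact B → Convex ℝ B → ∃ σ : ℝ, 0 < σ ∧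
    ∀ x ∈ B, ∀ y ∈ B, ((σ / 2 * ‖x - y‖ ^ 2 : ℝ) : EReal) ≤ bregman h x y

/-- `x` is a sequence generated by Model BPG with step sizes `τ k ∈ [τlo, τhi]`. -/
structure IsModelBPG (f h : Euc N → EReal) (m : Euc N → Euc N → EReal) (Lu : ℝ)
    (τlo τhi : ℝ) (τ : ℕ → ℝ) (x : ℕ → Euc N) : Prop where
  τlo_pos : 0 < τlo
  τlo_lt : τlo < τhi
  τhi_lt : τhi < 1 / Lu
  init_eq : x 0 = x 1
  init_mem : x 0 ∈ edom f ∩ interior (edom h)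
  step_mem : ∀ k, 1 ≤ k → τ k ∈ Icc τlo τhi
  update : ∀ k, 1 ≤ k →
    IsMinOn (fun z => m z (x k) + ((1 / τ k : ℝ) : EReal) * bregman h z (x k)) univ (x (k + 1))

/-- The Lyapunov function `(x, y) ↦ m x y + L D_h(x, y)`. -/
def lyapunov (h : Euc N → EReal) (m : Euc N → Euc N → EReal) (Lu : ℝ) (z : Euc2 N) : EReal :=
  m z.fst z.snd + (Lu : EReal) * bregman h z.fst z.snd

end ModelBPG

end

/-!
Along the iterates the Lyapunov function `F (x, y) = m x y + L D_h(x, y)` has the three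
properties of an abstract descent method. It decreases by at least `a ‖x (k + 1) - x k‖ ^ 2`,
because `x (k + 1)` is at least as good as `x k` in its own subproblem and `D_h` is locally
strongly convex. It has subgradients of norm `O(‖x (k + 1) - x k‖)`: the sum rule for the
subproblem gives the component in `x`, the assumption on the partial subgradients in the model
centre gives the component in `y`, and regularity or separability of the joint subdifferential
combines the two. Finally, the Kurdyka–Łojasiewicz inequality turns this bound into
`e k ^ θ ≤ C ‖x (k + 1) - x k‖` for the energy `e k = F (x (k + 1), x k) - F (xbar, xbar)`.

The rates follow from the recursion `e (k + 1) ^ (2 θ) ≤ M (e k - e (k + 1))`. For `θ ≤ 1 / 2`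
it is dominated by a geometric one. For `θ > 1 / 2` it makes `e k ^ (1 - 2 θ)` grow linearly,
and concavity of `s ↦ s ^ (1 - θ)` bounds `‖x k - xbar‖` by a multiple of `e k ^ (1 - θ)`. For
`θ = 0` the energy cannot stay positive while the steps tend to zero.

The subdifferential calculus rests on penalization: decoupling the variables of a composition
and penalizing the mismatch gives approximate chain rules for Fréchet subgradients, and the
horizon conditions keep the subgradients bounded in the limit.
-/

noncomputable section

namespace ModelBPG

section Gradient

variable {V W : Type*} [NormedAddCommGroup V] [InnerProductSpace ℝ V] [CompleteSpace V]
  [NormedAddCommGroup W] [InnerProductSpace ℝ W] [CompleteSpace W]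

lemma hasGradientAt_add {φ ψ : V → ℝ} {a b x : V} (hφ : HasGradientAt φ a x)
    (hψ : HasGradientAt ψ b x) : HasGradientAt (fun z => φ z + ψ z) (a + b) x := by
  rw [hasGradientAt_iff_hasFDerivAt, map_add]
  exact hφ.hasFDerivAt.add hψ.hasFDerivAt

lemma hasGradientAt_const_mul {φ : V → ℝ} {a x : V} (c : ℝ) (hφ : HasGradientAt φ a x) :
    HasGradientAt (fun z => c * φ z) (c • a) x := by
  rw [hasGradientAt_iff_hasFDerivAt, map_smul]
  exact hφ.hasFDerivAt.const_mul c

lemma hasGradientAt_neg {φ : V → ℝ} {a x : V} (hφ : HasGradientAt φ a x) :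
    HasGradientAt (fun z => -φ z) (-a) x := by
  simpa using hasGradientAt_const_mul (-1) hφ

lemma hasGradientAt_inner_sub (w c x : V) : HasGradientAt (fun z => inner ℝ w (z - c)) w x := by
  rw [hasGradientAt_iff_hasFDerivAt]
  exact (InnerProductSpace.toDual ℝ V w).hasFDerivAt.comp x ((hasFDerivAt_id x).sub_const c)

lemma hasGradientAt_norm_sub_sq (w x : V) :
    HasGradientAt (fun z => ‖z - w‖ ^ 2) ((2 : ℝ) • (x - w)) x := by
  rw [hasGradientAt_iff_hasFDerivAt]
  refine ((hasFDerivAt_id x).sub_const w).norm_sq.congr_fderiv ?_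
  ext d
  simp

lemma hasGradientAt_norm {x : V} (hx : x ≠ 0) :
    HasGradientAt (fun z : V => ‖z‖) (‖x‖⁻¹ • x) x := by
  rw [hasGradientAt_iff_hasFDerivAt]
  have hsq : ‖x‖ ^ 2 ≠ 0 := by positivity
  have hsqrt := (hasStrictFDerivAt_norm_sq x).hasFDerivAt.sqrt hsq
  simp only [Real.sqrt_sq (norm_nonneg _)] at hsqrt
  refine hsqrt.congr_fderiv ?_
  ext d
  simp only [one_div, mul_inv_rev, smul_apply, coe_innerSL_apply, nsmul_eq_mul, Nat.cast_ofNat,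
    smul_eq_mul, map_smul, InnerProductSpace.toDual_apply_apply]
  ring

lemma hasGradientAt_comp_affine {φ : W → ℝ} {G a : W} {A : V →L[ℝ] W} {y : V}
    (hφ : HasGradientAt φ G (a + A y)) : HasGradientAt (fun y => φ (a + A y)) (A.adjoint G) y := by
  rw [hasGradientAt_iff_hasFDerivAt]
  refine (hφ.hasFDerivAt.comp y (A.hasFDerivAt.const_add a)).congr_fderiv ?_
  ext d
  simp [ContinuousLinearMap.adjoint_inner_left]

end Gradient

section Subgradients

variable {V : Type*} [NormedAddCommGroup V] [InnerProductSpace ℝ V]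

lemma exists_real_of_mem_edom {X : Type*} {f : X → EReal} (hbot : ∀ z, f z ≠ ⊥) {x : X}
    (hx : x ∈ edom f) : ∃ r : ℝ, f x = r :=
  ⟨(f x).toReal, (EReal.coe_toReal (ne_of_lt hx) (hbot x)).symm⟩

lemma mem_edom_of_eq_coe {X : Type*} {f : X → EReal} {x : X} {r : ℝ} (h : f x = r) :
    x ∈ edom f := by
  simp [edom, h]

lemma add_mem_frechetSubdiff [CompleteSpace V] {f F : V → EReal} {φ : V → ℝ} {x v G : V}
    (hv : v ∈ frechetSubdiff f x) (hφ : HasGradientAt φ G x)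
    (hF : ∀ᶠ z in 𝓝 x, F z = f z + (φ z : EReal)) : v + G ∈ frechetSubdiff F x := by
  obtain ⟨hx, hv⟩ := hv
  have hFx : F x = f x + (φ x : EReal) := hF.self_of_nhds
  refine ⟨?_, fun ε hε => ?_⟩
  · change F x < ⊤
    rw [hFx]
    exact EReal.add_lt_top hx.ne (EReal.coe_ne_top _)
  filter_upwards [hv (ε / 2) (half_pos hε), hF,
    (hasGradientAt_iff_isLittleO.1 hφ).def (half_pos hε)] with z hfz hFz hφz
  have hφz' : φ x + (inner ℝ G (z - x) - ε / 2 * ‖z - x‖) ≤ φ z := by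
    have := neg_le_of_abs_le hφz
    linarith
  rw [hFz, hFx]
  calc f x + (φ x : EReal) + ((inner ℝ (v + G) (z - x) - ε * ‖z - x‖ : ℝ) : EReal)
      = f x + ((inner ℝ v (z - x) - ε / 2 * ‖z - x‖ : ℝ) : EReal)
        + ((φ x + (inner ℝ G (z - x) - ε / 2 * ‖z - x‖) : ℝ) : EReal) := by
        rw [add_assoc, add_assoc, ← EReal.coe_add, ← EReal.coe_add, inner_add_left]
        congr 2
        ring
    _ ≤ f z + (φ z : EReal) := by gcongr

lemma zero_mem_frechetSubdiff {f : V → EReal} {x : V} (hx : x ∈ edom f)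
    (hmin : IsLocalMin f x) : (0 : V) ∈ frechetSubdiff f x := by
  refine ⟨hx, fun ε hε => ?_⟩
  filter_upwards [hmin] with z hz
  refine le_trans (add_le_of_nonpos_right ?_) hz
  rw [inner_zero_left, zero_sub]
  exact_mod_cast neg_nonpos.2 (by positivity)

lemma neg_mem_frechetSubdiff_of_isLocalMin_add [CompleteSpace V] {f : V → EReal} {φ : V → ℝ}
    {x G : V} (hx : x ∈ edom f) (hφ : HasGradientAt φ G x)
    (hmin : IsLocalMin (fun z => f z + (φ z : EReal)) x) : -G ∈ frechetSubdiff f x := by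
  have hzero : (0 : V) ∈ frechetSubdiff (fun z => f z + (φ z : EReal)) x :=
    zero_mem_frechetSubdiff (EReal.add_lt_top hx.ne (EReal.coe_ne_top _)) hmin
  rw [← zero_add (-G)]
  refine add_mem_frechetSubdiff hzero (hasGradientAt_neg hφ) (Eventually.of_forall fun z => ?_)
  rw [add_assoc, ← EReal.coe_add, add_neg_cancel, EReal.coe_zero, add_zero]

/-- Fréchet subgradients `w k` at points `y k` that converge to `x` together with the values of
`f`. Limits of such `w` form the limiting subdifferential, limits of `t k • w k` with `t k ↓ 0` the
horizon subdifferential. -/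
structure IsSubgradientSeq (f : V → EReal) (x : V) (y w : ℕ → V) : Prop where
  tendsto_point : Tendsto y atTop (𝓝 x)
  tendsto_value : Tendsto (fun k => f (y k)) atTop (𝓝 (f x))
  mem_frechetSubdiff : ∀ k, w k ∈ frechetSubdiff f (y k)

namespace IsSubgradientSeq

variable {f : V → EReal} {x v : V} {y w : ℕ → V}

lemma comp_strictMono (h : IsSubgradientSeq f x y w) {φ : ℕ → ℕ} (hφ : StrictMono φ) :
    IsSubgradientSeq f x (y ∘ φ) (w ∘ φ) :=
  ⟨h.tendsto_point.comp hφ.tendsto_atTop, h.tendsto_value.comp hφ.tendsto_atTop,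
    fun k => h.mem_frechetSubdiff (φ k)⟩

lemma mem_limSubdiff (h : IsSubgradientSeq f x y w) (hx : x ∈ edom f)
    (hw : Tendsto w atTop (𝓝 v)) : v ∈ limSubdiff f x :=
  ⟨hx, y, w, h.tendsto_point, h.tendsto_value, h.mem_frechetSubdiff, hw⟩

lemma mem_horizonSubdiff (h : IsSubgradientSeq f x y w) (hx : x ∈ edom f) {t : ℕ → ℝ}
    (htpos : ∀ k, 0 < t k) (ht : Tendsto t atTop (𝓝 0))
    (hw : Tendsto (fun k => t k • w k) atTop (𝓝 v)) : v ∈ horizonSubdiff f x :=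
  ⟨hx, y, w, t, h.tendsto_point, h.tendsto_value, h.mem_frechetSubdiff, htpos, ht, hw⟩

end IsSubgradientSeq

lemma mem_limSubdiff_iff {f : V → EReal} {x v : V} : v ∈ limSubdiff f x ↔
    x ∈ edom f ∧ ∃ y w, IsSubgradientSeq f x y w ∧ Tendsto w atTop (𝓝 v) :=
  ⟨fun ⟨hx, y, w, hy, hfy, hw, hwv⟩ => ⟨hx, y, w, ⟨hy, hfy, hw⟩, hwv⟩,
    fun ⟨hx, _, _, h, hwv⟩ => h.mem_limSubdiff hx hwv⟩

lemma mem_horizonSubdiff_iff {f : V → EReal} {x v : V} : v ∈ horizonSubdiff f x ↔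
    x ∈ edom f ∧ ∃ (y w : ℕ → V) (t : ℕ → ℝ), IsSubgradientSeq f x y w ∧
      (∀ k, 0 < t k) ∧ Tendsto t atTop (𝓝 0) ∧ Tendsto (fun k => t k • w k) atTop (𝓝 v) :=
  ⟨fun ⟨hx, y, w, t, hy, hfy, hw, htpos, ht, htw⟩ => ⟨hx, y, w, t, ⟨hy, hfy, hw⟩, htpos, ht, htw⟩,
    fun ⟨hx, _, _, _, h, htpos, ht, htw⟩ => h.mem_horizonSubdiff hx htpos ht htw⟩

lemma frechetSubdiff_subset_limSubdiff (f : V → EReal) (x : V) :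
    frechetSubdiff f x ⊆ limSubdiff f x := fun v hv =>
  ⟨hv.1, fun _ => x, fun _ => v, tendsto_const_nhds, tendsto_const_nhds, fun _ => hv,
    tendsto_const_nhds⟩

lemma add_mem_limSubdiff [CompleteSpace V] {f F : V → EReal} {φ : V → ℝ} {G : V → V} {x v : V}
    (hv : v ∈ limSubdiff f x) (hφ : ∀ᶠ z in 𝓝 x, HasGradientAt φ (G z) z) (hG : ContinuousAt G x)
    (hF : ∀ᶠ z in 𝓝 x, F z = f z + (φ z : EReal)) : v + G x ∈ limSubdiff F x := by
  obtain ⟨hx, y, w, h, hwv⟩ := mem_limSubdiff_iff.1 hv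
  have hFx : F x = f x + (φ x : EReal) := hF.self_of_nhds
  have hev : ∀ᶠ k in atTop, F (y k) = f (y k) + (φ (y k) : EReal) ∧
      w k + G (y k) ∈ frechetSubdiff F (y k) := by
    filter_upwards [h.tendsto_point.eventually hF.eventually_nhds,
      h.tendsto_point.eventually hφ] with k hFk hφk
    exact ⟨hFk.self_of_nhds, add_mem_frechetSubdiff (h.mem_frechetSubdiff k) hφk hFk⟩
  obtain ⟨K, hK⟩ := eventually_atTop.1 hev
  have hφy : Tendsto (fun k => (φ (y k) : EReal)) atTop (𝓝 (φ x)) :=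
    (continuous_coe_real_ereal.tendsto _).comp
      (hφ.self_of_nhds.continuousAt.tendsto.comp h.tendsto_point)
  have hsum : Tendsto (fun k => f (y k) + (φ (y k) : EReal)) atTop (𝓝 (F x)) := by
    rw [hFx]
    exact (EReal.continuousAt_add (p := (f x, (φ x : EReal))) (by simp) (by simp)).tendsto.comp
      (h.tendsto_value.prodMk_nhds hφy)
  have hseq : IsSubgradientSeq F x (fun k => y (k + K)) (fun k => w (k + K) + G (y (k + K))) :=
    ⟨(tendsto_add_atTop_iff_nat K).2 h.tendsto_point,
      ((tendsto_add_atTop_iff_nat K).2 hsum).congr fun k => (hK _ (by lia)).1.symm,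
      fun k => (hK _ (by lia)).2⟩
  refine hseq.mem_limSubdiff ?_ ((tendsto_add_atTop_iff_nat K
    (f := fun k => w k + G (y k))).2 (hwv.add (hG.tendsto.comp h.tendsto_point)))
  change F x < ⊤
  rw [hFx]
  exact EReal.add_lt_top hx.ne (EReal.coe_ne_top _)

end Subgradients

section Epigraph

variable {V : Type*} [NormedAddCommGroup V] [InnerProductSpace ℝ V]

lemma norm_toLp_le_add {X Y : Type*} [NormedAddCommGroup X] [NormedAddCommGroup Y] (a : X)
    (b : Y) : ‖WithLp.toLp 2 (a, b)‖ ≤ ‖a‖ + ‖b‖ := by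
  calc ‖WithLp.toLp 2 (a, b)‖ = ‖WithLp.toLp 2 (a, (0 : Y)) + WithLp.toLp 2 ((0 : X), b)‖ := by
        rw [← WithLp.toLp_add, Prod.mk_add_mk, add_zero, zero_add]
    _ ≤ ‖a‖ + ‖b‖ := by
        simpa only [WithLp.norm_toLp_fst, WithLp.norm_toLp_snd] using
          norm_add_le (WithLp.toLp 2 (a, (0 : Y))) (WithLp.toLp 2 ((0 : X), b))

lemma toLp_neg_one_mem_frechetNormalCone {f : V → EReal} {x v : V} {r : ℝ} (hr : f x = r)
    (hv : v ∈ frechetSubdiff f x) :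
    WithLp.toLp 2 (v, (-1 : ℝ)) ∈ frechetNormalCone (epigraph f) (WithLp.toLp 2 (x, r)) := by
  refine ⟨hr.le, fun ε hε => ?_⟩
  have hfst : Tendsto (fun p : WithLp 2 (V × ℝ) => p.fst) (𝓝 (WithLp.toLp 2 (x, r))) (𝓝 x) :=
    (WithLp.fstL 2 ℝ V ℝ).continuous.tendsto _
  filter_upwards [nhdsWithin_le_nhds (hfst.eventually (hv.2 ε hε)), self_mem_nhdsWithin]
    with p hp hpe
  have hsnd : r + (inner ℝ v (p.fst - x) - ε * ‖p.fst - x‖) ≤ p.snd := by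
    rw [hr] at hp
    exact_mod_cast hp.trans hpe
  have hnorm : ε * ‖p.fst - x‖ ≤ ε * ‖p - WithLp.toLp 2 (x, r)‖ := by
    gcongr
    exact WithLp.norm_fst_le _ (p - WithLp.toLp 2 (x, r))
  have hinner : inner ℝ (WithLp.toLp 2 (v, (-1 : ℝ))) (p - WithLp.toLp 2 (x, r))
      = inner ℝ v (p.fst - x) - (p.snd - r) := by
    rw [WithLp.prod_inner_apply]
    simp only [WithLp.ofLp_sub, Prod.fst_sub, WithLp.ofLp_fst, Prod.snd_sub, WithLp.ofLp_snd,
      RCLike.inner_apply, Real.ringHom_apply, mul_neg, mul_one, neg_sub]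
    ring
  linarith

lemma mem_frechetSubdiff_of_toLp_neg_one_mem {f : V → EReal} {x v : V} {r : ℝ} (hr : f x = r)
    (hv : WithLp.toLp 2 (v, (-1 : ℝ)) ∈ frechetNormalCone (epigraph f) (WithLp.toLp 2 (x, r))) :
    v ∈ frechetSubdiff f x := by
  refine ⟨mem_edom_of_eq_coe hr, fun ε hε => ?_⟩
  set s : V → ℝ := fun z => inner ℝ v (z - x) - ε * ‖z - x‖ with hs
  set C : ℝ := 1 + ‖v‖ + ε with hC
  have hCpos : 0 < C := by positivity
  have hs_le (z : V) : ‖s z‖ ≤ (‖v‖ + ε) * ‖z - x‖ := by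
    calc ‖s z‖ ≤ ‖inner ℝ v (z - x)‖ + ‖ε * ‖z - x‖‖ := norm_sub_le _ _
      _ ≤ ‖v‖ * ‖z - x‖ + ε * ‖z - x‖ := by
        gcongr
        · exact norm_inner_le_norm _ _
        · rw [Real.norm_of_nonneg (by positivity)]
      _ = _ := by ring
  have hlim : Tendsto (fun z => WithLp.toLp 2 (z, r + s z)) (𝓝 x) (𝓝 (WithLp.toLp 2 (x, r))) := by
    have hcont : Continuous fun z => WithLp.toLp 2 (z, r + s z) :=
      (WithLp.prod_continuous_toLp 2 V ℝ).comp (by fun_prop)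
    simpa [hs] using hcont.tendsto x
  filter_upwards [hlim.eventually
    (eventually_nhdsWithin_iff.1 (hv.2 (ε / (2 * C)) (by positivity)))] with z hz
  rw [hr, ← EReal.coe_add]
  -- If `z` violated the inequality, `(z, r + s z)` would be a point of the epigraph along which
  -- the normal `(v, -1)` increases at the rate `ε`.
  by_contra! hlt
  have hdiff : WithLp.toLp 2 (z, r + s z) - WithLp.toLp 2 (x, r) = WithLp.toLp 2 (z - x, s z) := by
    rw [← WithLp.toLp_sub, Prod.mk_sub_mk, add_sub_cancel_left]
  have hnormal := hz hlt.le
  rw [hdiff, WithLp.prod_inner_apply] at hnormal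
  have hrate : ε * ‖z - x‖ ≤ ε / 2 * ‖z - x‖ := by
    calc ε * ‖z - x‖ ≤ ε / (2 * C) * ‖WithLp.toLp 2 (z - x, s z)‖ := by simpa [hs] using hnormal
      _ ≤ ε / (2 * C) * (C * ‖z - x‖) := by
        gcongr
        linarith [norm_toLp_le_add (z - x) (s z), hs_le z, hC]
      _ = ε / 2 * ‖z - x‖ := by field_simp
  have hzx : ‖z - x‖ = 0 := le_antisymm (by nlinarith) (norm_nonneg _)
  rw [sub_eq_zero.1 (norm_eq_zero.1 hzx), hr] at hlt
  simp at hlt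

lemma IsRegularAt.limSubdiff_subset {f : V → EReal} (hbot : ∀ z, f z ≠ ⊥) {x : V}
    (hreg : IsRegularAt f x) : limSubdiff f x ⊆ frechetSubdiff f x := by
  intro v hv
  obtain ⟨hx, y, w, h, hwv⟩ := mem_limSubdiff_iff.1 hv
  have hreal {z : V} (hz : z ∈ edom f) : f z = (f z).toReal :=
    (EReal.coe_toReal hz.ne (hbot z)).symm
  refine mem_frechetSubdiff_of_toLp_neg_one_mem (hreal hx) ?_
  rw [← hreg.2.2.2.2]
  have htoLp := WithLp.prod_continuous_toLp 2 V ℝ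
  refine ⟨(hreal hx).le, fun k => WithLp.toLp 2 (y k, (f (y k)).toReal),
    fun k => WithLp.toLp 2 (w k, (-1 : ℝ)), ?_, fun k =>
    toLp_neg_one_mem_frechetNormalCone (hreal (h.mem_frechetSubdiff k).1) (h.mem_frechetSubdiff k),
    (htoLp.tendsto _).comp (hwv.prodMk_nhds tendsto_const_nhds)⟩
  exact (htoLp.tendsto _).comp (h.tendsto_point.prodMk_nhds
    ((EReal.tendsto_toReal hx.ne (hbot x)).comp h.tendsto_value))

end Epigraph

section Penalization

variable {X : Type*} [TopologicalSpace X]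

lemma lowerSemicontinuous_add_coe {f : X → EReal} {φ : X → ℝ} (hf : LowerSemicontinuous f)
    (hφ : Continuous φ) : LowerSemicontinuous fun z => f z + (φ z : EReal) :=
  hf.add' (continuous_coe_real_ereal.comp hφ).lowerSemicontinuous fun _ =>
    EReal.continuousAt_add (by simp) (by simp)

lemma eventually_coe_sub_lt {f : X → EReal} (hf : LowerSemicontinuous f) {x : X} {r ε : ℝ}
    (hr : f x = r) (hε : 0 < ε) : ∀ᶠ u in 𝓝 x, ((r - ε : ℝ) : EReal) < f u :=
  hf x _ (show _ < f x by rw [hr]; exact_mod_cast sub_lt_self r hε)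

lemma exists_nat_forall_coe_lt_add_mul {K : Set X} (hK : IsCompact K) {Ψ : X → EReal} {P : X → ℝ}
    (hΨ : LowerSemicontinuous Ψ) (hbot : ∀ z, Ψ z ≠ ⊥) (hP : Continuous P) (hP0 : ∀ z, 0 ≤ P z)
    {c : ℝ} (hc : ∀ z ∈ K, P z = 0 → (c : EReal) < Ψ z) :
    ∃ n : ℕ, ∀ z ∈ K, (c : EReal) < Ψ z + ((n * P z : ℝ) : EReal) := by
  refine hK.elim_directed_cover (fun n : ℕ => {z | (c : EReal) < Ψ z + ((n * P z : ℝ) : EReal)})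
    (fun n => (lowerSemicontinuous_add_coe hΨ (hP.const_mul _)).isOpen_preimage _) ?_
    (Monotone.directed_le ?_)
  · intro z hz
    rw [mem_iUnion]
    rcases (hP0 z).eq_or_lt with hPz | hPz
    · exact ⟨0, by simpa using hc z hz hPz.symm⟩
    · obtain ⟨M, -, hM⟩ := EReal.lt_iff_exists_real_btwn.1 (bot_lt_iff_ne_bot.2 (hbot z))
      obtain ⟨n, hn⟩ := exists_nat_gt ((c - M) / P z)
      have hcM : c ≤ M + n * P z := by linarith [(div_lt_iff₀ hPz).1 hn]
      refine ⟨n, (EReal.coe_le_coe_iff.2 hcM).trans_lt ?_⟩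
      rw [EReal.coe_add]
      exact EReal.add_lt_add_right_coe hM _
  · intro n n' hn z hz
    refine lt_of_lt_of_le (show (c : EReal) < Ψ z + ((n * P z : ℝ) : EReal) from hz) ?_
    gcongr
    exact hP0 z

/-- A local form of exactness of penalization: if the points of `K` with vanishing penalty and
`Ψ`-value at most `Ψ z₀` lie in `U`, then so does a minimizer for a large penalty parameter. -/
lemma exists_penalized_min {K U : Set X} (hK : IsCompact K) (hU : IsOpen U) {Ψ : X → EReal}
    {P : X → ℝ} (hΨ : LowerSemicontinuous Ψ) (hbot : ∀ z, Ψ z ≠ ⊥) (hP : Continuous P)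
    (hP0 : ∀ z, 0 ≤ P z) {z₀ : X} {r : ℝ} (hz₀ : z₀ ∈ K) (hPz₀ : P z₀ = 0) (hr : Ψ z₀ = r)
    (hfeas : ∀ z ∈ K, P z = 0 → Ψ z ≤ r → z ∈ U) :
    ∃ n : ℕ, ∃ z ∈ K ∩ U, Ψ z ≤ r ∧ IsMinOn (fun z => Ψ z + ((n * P z : ℝ) : EReal)) K z := by
  obtain ⟨n, hn⟩ := exists_nat_forall_coe_lt_add_mul (hK.diff hU) hΨ hbot hP hP0
    fun z hz hPz => lt_of_not_ge fun hle => hz.2 (hfeas z hz.1 hPz hle)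
  obtain ⟨z, hzK, hz⟩ := ((lowerSemicontinuous_add_coe hΨ
    (hP.const_mul (n : ℝ))).lowerSemicontinuousOn K).exists_isMinOn ⟨z₀, hz₀⟩ hK
  have hzr : Ψ z + ((n * P z : ℝ) : EReal) ≤ r := by simpa [hPz₀, hr] using hz hz₀
  refine ⟨n, z, ⟨hzK, by_contra fun hzU => (hn z ⟨hzK, hzU⟩).not_ge hzr⟩, ?_, hz⟩
  refine le_trans (le_add_of_nonneg_right ?_) hzr
  exact_mod_cast mul_nonneg n.cast_nonneg (hP0 z)

end Penalization

section ChainRule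

variable {E F : Type*} [NormedAddCommGroup E] [InnerProductSpace ℝ E] [NormedAddCommGroup F]
  [InnerProductSpace ℝ F]

lemma adjoint_mem_frechetSubdiff_comp [CompleteSpace E] [CompleteSpace F] {J : E → EReal} {a u : E}
    {A : F →L[ℝ] E} {y : F} (hu : u ∈ frechetSubdiff J (a + A y)) :
    A.adjoint u ∈ frechetSubdiff (fun y => J (a + A y)) y := by
  refine ⟨hu.1, fun ε hε => ?_⟩
  have hlim : Tendsto (fun y => a + A y) (𝓝 y) (𝓝 (a + A y)) :=
    Continuous.tendsto (by fun_prop) y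
  filter_upwards [hlim.eventually (hu.2 (ε / (‖A‖ + 1)) (by positivity))] with z hz
  refine le_trans ?_ hz
  have hinner : inner ℝ (A.adjoint u) (z - y) = inner ℝ u (a + A z - (a + A y)) := by
    rw [A.adjoint_inner_left, map_sub, add_sub_add_left_eq_sub]
  have hnorm : ‖a + A z - (a + A y)‖ ≤ (‖A‖ + 1) * ‖z - y‖ := by
    rw [add_sub_add_left_eq_sub, ← map_sub]
    exact (A.le_opNorm _).trans (by gcongr; exact le_add_of_nonneg_right zero_le_one)
  have hε' : ε / (‖A‖ + 1) * ‖a + A z - (a + A y)‖ ≤ ε * ‖z - y‖ := by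
    rw [div_mul_eq_mul_div, div_le_iff₀ (by positivity)]
    nlinarith
  rw [hinner]
  gcongr

/-- Stationarity of the decoupled problem `J z + ψ y + n‖z - (a + A y)‖²` in `z` and in `y`. -/
lemma exists_mem_frechetSubdiff_adjoint_eq_neg [CompleteSpace E] [CompleteSpace F] {J : E → EReal}
    {ψ : F → ℝ} {A : F →L[ℝ] E} {a z : E} {y G : F} {n s : ℝ} (hs : J z = s)
    (hψ : HasGradientAt ψ G y)
    (hmin : IsLocalMin (fun p : F × E =>
      J p.2 + ((ψ p.1 + n * ‖p.2 - (a + A p.1)‖ ^ 2 : ℝ) : EReal)) (y, z)) :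
    ∃ u ∈ frechetSubdiff J z, A.adjoint u = -G := by
  refine ⟨-(0 + n • (2 : ℝ) • (z - (a + A y))), ?_, ?_⟩
  · refine neg_mem_frechetSubdiff_of_isLocalMin_add (mem_edom_of_eq_coe hs)
      (hasGradientAt_add (hasGradientAt_const z (ψ y))
        (hasGradientAt_const_mul n (hasGradientAt_norm_sub_sq (a + A y) z))) ?_
    exact (Continuous.prodMk_right y).tendsto z |>.eventually hmin
  · have hy : IsLocalMin (fun y' => ψ y' + n * ‖a + A y' - z‖ ^ 2) y := by
      filter_upwards [(Continuous.prodMk_left z).tendsto y |>.eventually hmin] with y' hy'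
      simpa only [hs, ← EReal.coe_add, EReal.coe_le_coe_iff, norm_sub_rev z,
        add_le_add_iff_left] using hy'
    have hgrad := hasGradientAt_add hψ (hasGradientAt_comp_affine
      (hasGradientAt_const_mul n (hasGradientAt_norm_sub_sq z (a + A y))))
    have hzero := hy.hasFDerivAt_eq_zero hgrad.hasFDerivAt
    rw [map_eq_zero_iff _ (InnerProductSpace.toDual ℝ F).injective] at hzero
    rw [eq_neg_iff_add_eq_zero, ← hzero, zero_add, ← smul_neg, ← smul_neg, neg_sub, add_comm]

lemma exists_isLocalMin_decoupled [ProperSpace E] [ProperSpace F] {J : E → EReal}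
    (hJ : LowerSemicontinuous J) (hbot : ∀ z, J z ≠ ⊥) {ψ : F → ℝ} (hψ : Continuous ψ) {a : E}
    {A : F →L[ℝ] E} {y₀ : F} {r δ ρ : ℝ} (hδ : 0 < δ) (hρ : 0 < ρ)
    (hr : J (a + A y₀) + (ψ y₀ : EReal) = r)
    (hA : ∀ y ∈ Metric.closedBall y₀ δ, a + A y ∈ Metric.ball (a + A y₀) ρ)
    (hfeas : ∀ y ∈ Metric.closedBall y₀ δ, J (a + A y) + (ψ y : EReal) ≤ r →
      y ∈ Metric.ball y₀ δ) :
    ∃ n : ℕ, ∃ y ∈ Metric.ball y₀ δ, ∃ z ∈ Metric.ball (a + A y₀) ρ, J z + (ψ y : EReal) ≤ r ∧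
      IsLocalMin (fun p : F × E =>
        J p.2 + ((ψ p.1 + n * ‖p.2 - (a + A p.1)‖ ^ 2 : ℝ) : EReal)) (y, z) := by
  set K : Set (F × E) := Metric.closedBall y₀ δ ×ˢ Metric.closedBall (a + A y₀) ρ
  set U : Set (F × E) := Metric.ball y₀ δ ×ˢ Metric.ball (a + A y₀) ρ
  have hUopen : IsOpen U := Metric.isOpen_ball.prod Metric.isOpen_ball
  have hgraph : ∀ p ∈ K, ‖p.2 - (a + A p.1)‖ ^ 2 = 0 → J p.2 + (ψ p.1 : EReal) ≤ r → p ∈ U := by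
    rintro ⟨y, z⟩ ⟨hy, -⟩ hP hle
    obtain rfl : z = a + A y := by simpa [sub_eq_zero] using hP
    exact ⟨hfeas y hy hle, hA y hy⟩
  obtain ⟨n, ⟨y, z⟩, ⟨-, hyz⟩, hle, hmin⟩ := exists_penalized_min
    ((isCompact_closedBall _ _).prod (isCompact_closedBall _ _)) hUopen
    (lowerSemicontinuous_add_coe (hJ.comp continuous_snd) (hψ.comp continuous_fst))
    (fun p => by simp [EReal.add_eq_bot_iff, hbot]) (by fun_prop) (fun p => by positivity)
    (show (y₀, a + A y₀) ∈ K from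
      ⟨Metric.mem_closedBall_self hδ.le, Metric.mem_closedBall_self hρ.le⟩) (by simp) hr hgraph
  refine ⟨n, y, hyz.1, z, hyz.2, hle, ?_⟩
  filter_upwards [hmin.isLocalMin (mem_of_superset (hUopen.mem_nhds hyz)
    (prod_mono Metric.ball_subset_closedBall Metric.ball_subset_closedBall))] with p hp
  simpa only [EReal.coe_add, add_assoc, Function.comp_apply] using hp

lemma norm_sub_lt_of_add_tilt_le {g : F → EReal} {y y₀ w : F} {r δ ε : ℝ} (hδ : 0 < δ)
    (hε : 0 < ε) (hr : g y₀ = r)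
    (hfrechet : g y₀ + ((inner ℝ w (y - y₀) - ε / 4 * ‖y - y₀‖ : ℝ) : EReal) ≤ g y)
    (hle : g y + ((ε / (2 * δ) * ‖y - y₀‖ ^ 2 + inner ℝ (-w) (y - y₀) : ℝ) : EReal) ≤ r) :
    ‖y - y₀‖ < δ := by
  have hsum := (add_le_add_left hfrechet _).trans hle
  rw [hr, inner_neg_left] at hsum
  norm_cast at hsum
  by_contra! hfar
  have hquad : ε / 2 ≤ ε / (2 * δ) * ‖y - y₀‖ := by
    rw [← mul_div_mul_right ε 2 hδ.ne', mul_div_right_comm]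
    gcongr
  nlinarith

/-- Fuzzy chain rule. The tilted function `J z + κ‖y - y₀‖² - ⟨w, y - y₀⟩`, with a penalty for
`z ≠ a + A y`, has an interior minimizer since on the graph the Fréchet inequality for `w` beats the
quadratic term at distance `δ`. -/
lemma exists_mem_frechetSubdiff_norm_adjoint_sub_le [ProperSpace E] [ProperSpace F] {J : E → EReal}
    (hJ : LowerSemicontinuous J) (hbot : ∀ z, J z ≠ ⊥) {a : E} {A : F →L[ℝ] E} {y₀ w : F}
    (hw : w ∈ frechetSubdiff (fun y => J (a + A y)) y₀) {r : ℝ} (hr : J (a + A y₀) = r) {ε : ℝ}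
    (hε : 0 < ε) :
    ∃ z u, ∃ s : ℝ, J z = s ∧ u ∈ frechetSubdiff J z ∧ ‖z - (a + A y₀)‖ ≤ ε ∧ |s - r| ≤ ε ∧
      ‖A.adjoint u - w‖ ≤ ε := by
  obtain ⟨ρ, hρ, hball⟩ := Metric.nhds_basis_closedBall.mem_iff.1
    ((eventually_coe_sub_lt hJ hr hε).and (Metric.closedBall_mem_nhds _ hε))
  have hmap : ∀ᶠ y in 𝓝 y₀, a + A y ∈ Metric.ball (a + A y₀) ρ :=
    (Continuous.tendsto (by fun_prop) y₀).eventually (Metric.ball_mem_nhds _ hρ)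
  have hslope : ∀ᶠ y in 𝓝 y₀, inner ℝ w (y - y₀) < ε :=
    (Continuous.tendsto (by fun_prop) y₀).eventually_lt_const (by simpa using hε)
  obtain ⟨δ, hδ, hnear⟩ := Metric.nhds_basis_closedBall.mem_iff.1
    ((hw.2 (ε / 4) (by positivity)).and (hmap.and hslope))
  set κ : ℝ := ε / (2 * δ)
  have hκδ : κ * (2 * δ) = ε := div_mul_cancel₀ _ (by positivity)
  set ψ : F → ℝ := fun y => κ * ‖y - y₀‖ ^ 2 + inner ℝ (-w) (y - y₀) with hψ
  have hfeas : ∀ y ∈ Metric.closedBall y₀ δ, J (a + A y) + (ψ y : EReal) ≤ r →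
      y ∈ Metric.ball y₀ δ := fun y hy hle =>
    mem_ball_iff_norm.2
      (norm_sub_lt_of_add_tilt_le (g := fun y => J (a + A y)) hδ hε hr (hnear hy).1 hle)
  obtain ⟨n, y, hy, z, hz, hle, hmin⟩ := exists_isLocalMin_decoupled hJ hbot (ψ := ψ)
    (by fun_prop) hδ hρ (by simpa [hψ] using hr) (fun y hy => (hnear hy).2.1) hfeas
  obtain ⟨hrz, hzε⟩ := hball (Metric.ball_subset_closedBall hz)
  have hψy : -ε ≤ ψ y := by
    have : 0 ≤ κ * ‖y - y₀‖ ^ 2 := by positivity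
    have := (hnear (Metric.ball_subset_closedBall hy)).2.2
    simp only [hψ, inner_neg_left]
    linarith
  have hztop : J z ≠ ⊤ := fun htop => by simp [htop] at hle
  obtain ⟨s, hs⟩ := exists_real_of_mem_edom hbot (lt_top_iff_ne_top.2 hztop)
  obtain ⟨u, hu, hAu⟩ := exists_mem_frechetSubdiff_adjoint_eq_neg hs
    (hasGradientAt_add (hasGradientAt_const_mul κ (hasGradientAt_norm_sub_sq y₀ y))
      (hasGradientAt_inner_sub (-w) y₀ y)) hmin
  rw [hs] at hle hrz
  norm_cast at hle hrz
  refine ⟨z, u, s, hs, hu, mem_closedBall_iff_norm.1 hzε, abs_le.2 ⟨by linarith, by linarith⟩, ?_⟩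
  have hdiff : A.adjoint u - w = -((κ * 2) • (y - y₀)) := by rw [hAu]; module
  rw [hdiff, norm_neg, norm_smul, Real.norm_of_nonneg (by positivity), ← hκδ, mul_assoc]
  gcongr
  exact (mem_ball_iff_norm.1 hy).le

omit [InnerProductSpace ℝ E] in
lemma exists_subseq_tendsto_or_direction [NormedSpace ℝ E] [ProperSpace E] (p : ℕ → E) :
    (∃ a, ∃ φ : ℕ → ℕ, StrictMono φ ∧ Tendsto (p ∘ φ) atTop (𝓝 a)) ∨
    (∃ a, ∃ φ : ℕ → ℕ, StrictMono φ ∧ ‖a‖ = 1 ∧ (∀ n, 0 < ‖p (φ n)‖) ∧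
      Tendsto (fun n => ‖p (φ n)‖⁻¹) atTop (𝓝 0) ∧
      Tendsto (fun n => ‖p (φ n)‖⁻¹ • p (φ n)) atTop (𝓝 a)) := by
  by_cases hblowup : Tendsto (fun n => ‖p n‖) atTop atTop
  · right
    obtain ⟨K, hK⟩ := eventually_atTop.1 (hblowup.eventually (eventually_gt_atTop 0))
    have hsphere : ∀ n, ‖p (n + K)‖⁻¹ • p (n + K) ∈ Metric.sphere (0 : E) 1 := fun n => by
      simp [norm_smul, (hK (n + K) (by lia)).ne']
    obtain ⟨a, ha, φ, hφ, hlim⟩ := (isCompact_sphere (0 : E) 1).tendsto_subseq hsphere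
    have hφK : StrictMono fun n => φ n + K := fun a b hab => by simpa using hφ hab
    exact ⟨a, fun n => φ n + K, hφK, by simpa using ha, fun n => hK _ (by lia),
      tendsto_inv_atTop_zero.comp (hblowup.comp hφK.tendsto_atTop), hlim⟩
  · left
    simp only [tendsto_atTop, not_forall, not_eventually, not_le] at hblowup
    obtain ⟨C, hC⟩ := hblowup
    obtain ⟨a, -, φ, hφ, hlim⟩ := tendsto_subseq_of_frequently_bounded
      Metric.isBounded_closedBall (hC.mono fun n hn => mem_closedBall_zero_iff.2 hn.le)
    exact ⟨a, φ, hφ, hlim⟩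

lemma IsSubgradientSeq.exists_adjoint_eq [ProperSpace E] [CompleteSpace F] {J : E → EReal}
    {A : F →L[ℝ] E} {x : E} {y u : ℕ → E} {w : F} (hseq : IsSubgradientSeq J x y u)
    (hx : x ∈ edom J) (hw : Tendsto (fun n => A.adjoint (u n)) atTop (𝓝 w))
    (hqual : ∀ v ∈ horizonSubdiff J x, A.adjoint v = 0 → v = 0) :
    ∃ v ∈ limSubdiff J x, A.adjoint v = w := by
  rcases exists_subseq_tendsto_or_direction u with
    ⟨v, φ, hφ, hv⟩ | ⟨v, φ, hφ, hnorm, hpos, hinv, hv⟩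
  · exact ⟨v, (hseq.comp_strictMono hφ).mem_limSubdiff hx hv, tendsto_nhds_unique
      ((A.adjoint.continuous.tendsto v).comp hv) (hw.comp hφ.tendsto_atTop)⟩
  · have hhor := (hseq.comp_strictMono hφ).mem_horizonSubdiff hx
      (fun n => inv_pos.2 (hpos n)) hinv hv
    have hzero : A.adjoint v = 0 := by
      refine tendsto_nhds_unique ((A.adjoint.continuous.tendsto v).comp hv) ?_
      simpa only [Function.comp_def, map_smul, zero_smul] using
        hinv.smul (hw.comp hφ.tendsto_atTop)
    simp [hqual v hhor hzero] at hnorm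

lemma exists_mem_limSubdiff_adjoint_eq [ProperSpace E] [ProperSpace F] {J : E → EReal}
    (hJ : LowerSemicontinuous J) (hbot : ∀ z, J z ≠ ⊥) {a : E} {A : F →L[ℝ] E} {y w : F}
    (hw : w ∈ limSubdiff (fun y => J (a + A y)) y)
    (hqual : ∀ u ∈ horizonSubdiff J (a + A y), A.adjoint u = 0 → u = 0) :
    ∃ u ∈ limSubdiff J (a + A y), A.adjoint u = w := by
  obtain ⟨hy, y', w', hseq, hw'⟩ := mem_limSubdiff_iff.1 hw
  obtain ⟨r, hr⟩ := exists_real_of_mem_edom (fun y => hbot (a + A y)) hy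
  choose r' hr' using fun n => exists_real_of_mem_edom (fun y => hbot (a + A y))
    (hseq.mem_frechetSubdiff n).1
  choose z u s hs hu hz hsr hAu using fun n : ℕ => exists_mem_frechetSubdiff_norm_adjoint_sub_le
    hJ hbot (hseq.mem_frechetSubdiff n) (hr' n) (Nat.one_div_pos_of_nat (n := n) (α := ℝ))
  have hε : Tendsto (fun n : ℕ => 1 / ((n : ℝ) + 1)) atTop (𝓝 0) :=
    tendsto_one_div_add_atTop_nhds_zero_nat
  have hr'lim : Tendsto r' atTop (𝓝 r) := by
    rw [← EReal.tendsto_coe, ← hr]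
    exact hseq.tendsto_value.congr hr'
  have hslim : Tendsto s atTop (𝓝 r) :=
    (tendsto_iff_of_dist (squeeze_zero (fun n => dist_nonneg) hsr hε)).2 hr'lim
  have hzlim : Tendsto z atTop (𝓝 (a + A y)) := by
    have haA : Tendsto (fun n => a + A (y' n)) atTop (𝓝 (a + A y)) :=
      tendsto_const_nhds.add ((A.continuous.tendsto y).comp hseq.tendsto_point)
    refine (tendsto_iff_of_dist (squeeze_zero (fun n => dist_nonneg) (fun n => ?_) hε)).2 haA
    exact (dist_eq_norm _ _).trans_le (hz n)
  have hzu : IsSubgradientSeq J (a + A y) z u := by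
    refine ⟨hzlim, ?_, hu⟩
    simpa only [hr, hs, EReal.tendsto_coe] using hslim
  refine hzu.exists_adjoint_eq hy ?_ hqual
  refine (tendsto_iff_of_dist (squeeze_zero (fun n => dist_nonneg) (fun n => ?_) hε)).2 hw'
  exact (dist_eq_norm _ _).trans_le (hAu n)

end ChainRule

section SeparableSum

variable {E F : Type*} {g : E → EReal} {k : F → EReal}

/-- The separable sum `(x, y) ↦ g x + k y` on the Euclidean product. -/
def separableSum (g : E → EReal) (k : F → EReal) (p : WithLp 2 (E × F)) : EReal :=
  g p.fst + k p.snd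

lemma separableSum_ne_bot (hg : ∀ z, g z ≠ ⊥) (hk : ∀ z, k z ≠ ⊥) (p : WithLp 2 (E × F)) :
    separableSum g k p ≠ ⊥ := by
  simp [separableSum, EReal.add_eq_bot_iff, hg, hk]

lemma lowerSemicontinuous_separableSum [TopologicalSpace E] [TopologicalSpace F]
    (hg : LowerSemicontinuous g) (hk : LowerSemicontinuous k)
    (hgbot : ∀ z, g z ≠ ⊥) (hkbot : ∀ z, k z ≠ ⊥) : LowerSemicontinuous (separableSum g k) :=
  (hg.comp (WithLp.prod_continuous_ofLp 2 E F).fst).add'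
    (hk.comp (WithLp.prod_continuous_ofLp 2 E F).snd)
    fun _ => EReal.continuousAt_add (Or.inr (hkbot _)) (Or.inl (hgbot _))

lemma mem_edom_separableSum_iff (hg : ∀ z, g z ≠ ⊥) (hk : ∀ z, k z ≠ ⊥) {p : WithLp 2 (E × F)} :
    p ∈ edom (separableSum g k) ↔ p.fst ∈ edom g ∧ p.snd ∈ edom k := by
  simp [edom, separableSum, lt_top_iff_ne_top, EReal.add_ne_top_iff_ne_top₂ (hg _) (hk _)]

/-- Lower semicontinuity turns convergence of a sum into convergence of its terms. -/
lemma tendsto_of_tendsto_add [TopologicalSpace E] [TopologicalSpace F]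
    (hg : LowerSemicontinuous g) (hk : LowerSemicontinuous k)
    {x : E} {y : F} {a b : ℝ} (ha : g x = a) (hb : k y = b) {u : ℕ → E} {v : ℕ → F}
    (hu : Tendsto u atTop (𝓝 x)) (hv : Tendsto v atTop (𝓝 y))
    (hsum : Tendsto (fun n => g (u n) + k (v n)) atTop (𝓝 (g x + k y))) :
    Tendsto (fun n => g (u n)) atTop (𝓝 (g x)) := by
  refine tendsto_order.2 ⟨fun c hc => hu.eventually (hg x c hc), fun c hc => ?_⟩
  obtain ⟨d, had, hdc⟩ := EReal.lt_iff_exists_real_btwn.1 hc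
  rw [ha, EReal.coe_lt_coe_iff] at had
  set ε := (d - a) / 2 with hε
  have hεpos : 0 < ε := by linarith
  have hlt : g x + k y < ((a + b + ε : ℝ) : EReal) := by
    rw [ha, hb, ← EReal.coe_add, EReal.coe_lt_coe_iff]
    linarith
  filter_upwards [hsum.eventually_lt_const hlt, hv.eventually (eventually_coe_sub_lt hk hb hεpos)]
    with n hn hkn
  refine lt_of_not_ge fun hcg => hn.not_ge ?_
  calc ((a + b + ε : ℝ) : EReal) = (d : EReal) + ((b - ε : ℝ) : EReal) := by
        rw [← EReal.coe_add]; congr 1; linarith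
    _ ≤ g (u n) + k (v n) := add_le_add (hdc.le.trans hcg) hkn.le

end SeparableSum

section SumRule

variable {V E F : Type*} [NormedAddCommGroup V] [InnerProductSpace ℝ V] [NormedAddCommGroup E]
  [InnerProductSpace ℝ E] [NormedAddCommGroup F] [InnerProductSpace ℝ F]

/-- The map `x ↦ (B x, C x)` into the Euclidean product: an inclusion of a factor if `B` or `C`
vanishes, the diagonal if both are the identity. -/
def toLpProd (B : V →L[ℝ] E) (C : V →L[ℝ] F) : V →L[ℝ] WithLp 2 (E × F) :=
  (WithLp.prodContinuousLinearEquiv 2 ℝ E F).symm ∘L (B.prod C)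

lemma toLpProd_apply (B : V →L[ℝ] E) (C : V →L[ℝ] F) (x : V) :
    toLpProd B C x = WithLp.toLp 2 (B x, C x) := rfl

lemma toLp_zero_add_toLpProd_id (x : E) (y : F) :
    WithLp.toLp 2 (0, y) + toLpProd (.id ℝ E) 0 x = WithLp.toLp 2 (x, y) := by
  simp [toLpProd_apply, ← WithLp.toLp_add]

lemma toLp_add_toLpProd_zero_id (x : E) (y : F) :
    WithLp.toLp 2 (x, 0) + toLpProd 0 (.id ℝ F) y = WithLp.toLp 2 (x, y) := by
  simp [toLpProd_apply, ← WithLp.toLp_add]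

variable [CompleteSpace E] [CompleteSpace F]

lemma adjoint_toLpProd [CompleteSpace V] (B : V →L[ℝ] E)
    (C : V →L[ℝ] F) (u : WithLp 2 (E × F)) :
    (toLpProd B C).adjoint u = B.adjoint u.fst + C.adjoint u.snd := by
  refine ext_inner_right ℝ fun x => ?_
  rw [ContinuousLinearMap.adjoint_inner_left, toLpProd_apply, WithLp.prod_inner_apply,
    inner_add_left, ContinuousLinearMap.adjoint_inner_left, ContinuousLinearMap.adjoint_inner_left]
  rfl

lemma adjoint_fstL (v : E) : (WithLp.fstL 2 ℝ E F).adjoint v = WithLp.toLp 2 (v, 0) := by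
  refine ext_inner_right ℝ fun x => ?_
  simp [ContinuousLinearMap.adjoint_inner_left, WithLp.prod_inner_apply]

lemma adjoint_toLpProd_id_zero (u : WithLp 2 (E × F)) :
    (toLpProd (.id ℝ E) (0 : E →L[ℝ] F)).adjoint u = u.fst := by
  rw [adjoint_toLpProd, ContinuousLinearMap.adjoint_id, map_zero]
  simp

lemma adjoint_toLpProd_zero_id (u : WithLp 2 (E × F)) :
    (toLpProd (0 : F →L[ℝ] E) (.id ℝ F)).adjoint u = u.snd := by
  rw [adjoint_toLpProd, ContinuousLinearMap.adjoint_id, map_zero]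
  simp

lemma mem_frechetSubdiff_of_add_coe {g : E → EReal} {x v : E} {b : ℝ}
    (hv : v ∈ frechetSubdiff (fun z => g z + (b : EReal)) x) : v ∈ frechetSubdiff g x := by
  rw [← add_zero v]
  refine add_mem_frechetSubdiff hv (hasGradientAt_const x (-b)) (Eventually.of_forall fun z => ?_)
  rw [add_assoc, ← EReal.coe_add, add_neg_cancel, EReal.coe_zero, add_zero]

lemma fst_mem_frechetSubdiff {J : WithLp 2 (E × F) → EReal} {x : E} {y : F} {u : WithLp 2 (E × F)}
    (hu : u ∈ frechetSubdiff J (WithLp.toLp 2 (x, y))) :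
    u.fst ∈ frechetSubdiff (fun x' => J (WithLp.toLp 2 (x', y))) x := by
  simpa only [adjoint_toLpProd_id_zero, toLp_zero_add_toLpProd_id] using
    adjoint_mem_frechetSubdiff_comp (a := WithLp.toLp 2 (0, y)) (A := toLpProd (.id ℝ E) 0)
      ((toLp_zero_add_toLpProd_id x y).symm ▸ hu)

lemma snd_mem_frechetSubdiff {J : WithLp 2 (E × F) → EReal} {x : E} {y : F} {u : WithLp 2 (E × F)}
    (hu : u ∈ frechetSubdiff J (WithLp.toLp 2 (x, y))) :
    u.snd ∈ frechetSubdiff (fun y' => J (WithLp.toLp 2 (x, y'))) y := by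
  simpa only [adjoint_toLpProd_zero_id, toLp_add_toLpProd_zero_id] using
    adjoint_mem_frechetSubdiff_comp (a := WithLp.toLp 2 (x, 0)) (A := toLpProd 0 (.id ℝ F))
      ((toLp_add_toLpProd_zero_id x y).symm ▸ hu)

variable {g : E → EReal} {k : F → EReal}

lemma fst_snd_mem_frechetSubdiff_of_separableSum (hg : ∀ z, g z ≠ ⊥) (hk : ∀ z, k z ≠ ⊥)
    {p u : WithLp 2 (E × F)} (hu : u ∈ frechetSubdiff (separableSum g k) p) :
    u.fst ∈ frechetSubdiff g p.fst ∧ u.snd ∈ frechetSubdiff k p.snd := by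
  obtain ⟨hfst, hsnd⟩ := (mem_edom_separableSum_iff hg hk).1 hu.1
  obtain ⟨a, ha⟩ := exists_real_of_mem_edom hg hfst
  obtain ⟨b, hb⟩ := exists_real_of_mem_edom hk hsnd
  constructor
  · have hpartial : u.fst ∈ frechetSubdiff (fun z => g z + k p.snd) p.fst :=
      fst_mem_frechetSubdiff hu
    rw [hb] at hpartial
    exact mem_frechetSubdiff_of_add_coe hpartial
  · have hpartial : u.snd ∈ frechetSubdiff (fun z => g p.fst + k z) p.snd :=
      snd_mem_frechetSubdiff hu
    simp only [ha, add_comm (a : EReal)] at hpartial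
    exact mem_frechetSubdiff_of_add_coe hpartial

lemma IsSubgradientSeq.of_separableSum (hg : LowerSemicontinuous g) (hk : LowerSemicontinuous k)
    (hgbot : ∀ z, g z ≠ ⊥) (hkbot : ∀ z, k z ≠ ⊥) {p : WithLp 2 (E × F)}
    {q u : ℕ → WithLp 2 (E × F)} (hp : p ∈ edom (separableSum g k))
    (h : IsSubgradientSeq (separableSum g k) p q u) :
    IsSubgradientSeq g p.fst (fun n => (q n).fst) (fun n => (u n).fst) ∧
      IsSubgradientSeq k p.snd (fun n => (q n).snd) (fun n => (u n).snd) := by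
  obtain ⟨hfst, hsnd⟩ := (mem_edom_separableSum_iff hgbot hkbot).1 hp
  obtain ⟨a, ha⟩ := exists_real_of_mem_edom hgbot hfst
  obtain ⟨b, hb⟩ := exists_real_of_mem_edom hkbot hsnd
  have hqfst := ((WithLp.fstL 2 ℝ E F).continuous.tendsto p).comp h.tendsto_point
  have hqsnd := ((WithLp.sndL 2 ℝ E F).continuous.tendsto p).comp h.tendsto_point
  have hu := fun n => fst_snd_mem_frechetSubdiff_of_separableSum hgbot hkbot
    (h.mem_frechetSubdiff n)
  refine ⟨⟨hqfst, tendsto_of_tendsto_add hg hk ha hb hqfst hqsnd h.tendsto_value,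
    fun n => (hu n).1⟩, hqsnd, tendsto_of_tendsto_add hk hg hb ha hqsnd hqfst ?_, fun n => (hu n).2⟩
  simp only [add_comm (k _)]
  exact h.tendsto_value

lemma fst_snd_mem_limSubdiff_of_separableSum (hg : LowerSemicontinuous g)
    (hk : LowerSemicontinuous k) (hgbot : ∀ z, g z ≠ ⊥) (hkbot : ∀ z, k z ≠ ⊥)
    {p u : WithLp 2 (E × F)} (hu : u ∈ limSubdiff (separableSum g k) p) :
    u.fst ∈ limSubdiff g p.fst ∧ u.snd ∈ limSubdiff k p.snd := by
  obtain ⟨hp, q, v, hseq, hv⟩ := mem_limSubdiff_iff.1 hu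
  obtain ⟨hfst, hsnd⟩ := (mem_edom_separableSum_iff hgbot hkbot).1 hp
  obtain ⟨hseqg, hseqk⟩ := hseq.of_separableSum hg hk hgbot hkbot hp
  exact ⟨hseqg.mem_limSubdiff hfst (((WithLp.fstL 2 ℝ E F).continuous.tendsto u).comp hv),
    hseqk.mem_limSubdiff hsnd (((WithLp.sndL 2 ℝ E F).continuous.tendsto u).comp hv)⟩

lemma fst_snd_mem_horizonSubdiff_of_separableSum (hg : LowerSemicontinuous g)
    (hk : LowerSemicontinuous k) (hgbot : ∀ z, g z ≠ ⊥) (hkbot : ∀ z, k z ≠ ⊥)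
    {p u : WithLp 2 (E × F)} (hu : u ∈ horizonSubdiff (separableSum g k) p) :
    u.fst ∈ horizonSubdiff g p.fst ∧ u.snd ∈ horizonSubdiff k p.snd := by
  obtain ⟨hp, q, v, t, hseq, htpos, ht, htv⟩ := mem_horizonSubdiff_iff.1 hu
  obtain ⟨hfst, hsnd⟩ := (mem_edom_separableSum_iff hgbot hkbot).1 hp
  obtain ⟨hseqg, hseqk⟩ := hseq.of_separableSum hg hk hgbot hkbot hp
  exact ⟨hseqg.mem_horizonSubdiff hfst htpos ht
      (((WithLp.fstL 2 ℝ E F).continuous.tendsto u).comp htv),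
    hseqk.mem_horizonSubdiff hsnd htpos ht
      (((WithLp.sndL 2 ℝ E F).continuous.tendsto u).comp htv)⟩

end SumRule

/-- Sum rule at a minimizer: the chain rule for the composition of a separable sum with the
diagonal. -/
lemma exists_mem_limSubdiff_neg_mem_of_isMinOn_add {V : Type*} [NormedAddCommGroup V]
    [InnerProductSpace ℝ V] [FiniteDimensional ℝ V] {g k : V → EReal}
    (hg : LowerSemicontinuous g) (hk : LowerSemicontinuous k) (hgbot : ∀ z, g z ≠ ⊥)
    (hkbot : ∀ z, k z ≠ ⊥) {x : V} (hgx : x ∈ edom g) (hkx : x ∈ edom k)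
    (hmin : IsMinOn (fun z => g z + k z) univ x)
    (hqual : ∀ v ∈ horizonSubdiff g x, -v ∈ horizonSubdiff k x → v = 0) :
    ∃ p ∈ limSubdiff k x, -p ∈ limSubdiff g x := by
  set D := toLpProd (.id ℝ V) (.id ℝ V)
  have hD : ∀ u, D.adjoint u = u.fst + u.snd := fun u => by
    rw [adjoint_toLpProd, ContinuousLinearMap.adjoint_id]
    rfl
  have hx : 0 + D x = WithLp.toLp 2 (x, x) := zero_add _
  have hzero : (0 : V) ∈ limSubdiff (fun z => separableSum g k (0 + D z)) x := by
    simp only [zero_add]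
    exact frechetSubdiff_subset_limSubdiff _ _ (zero_mem_frechetSubdiff
      ((mem_edom_separableSum_iff hgbot hkbot).2 ⟨hgx, hkx⟩) (hmin.isLocalMin univ_mem))
  have hqualD : ∀ u ∈ horizonSubdiff (separableSum g k) (0 + D x), D.adjoint u = 0 → u = 0 := by
    intro u hu hDu
    rw [hx] at hu
    obtain ⟨hfst, hsnd⟩ := fst_snd_mem_horizonSubdiff_of_separableSum hg hk hgbot hkbot hu
    have hneg : -u.fst = u.snd := by rwa [hD, add_eq_zero_iff_neg_eq] at hDu
    have hfst0 : u.fst = 0 := hqual _ hfst (hneg ▸ hsnd)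
    have hsnd0 : u.snd = 0 := by rw [← hneg, hfst0, neg_zero]
    exact WithLp.ofLp_injective 2 (Prod.ext hfst0 hsnd0)
  obtain ⟨u, hu, hDu⟩ := exists_mem_limSubdiff_adjoint_eq
    (lowerSemicontinuous_separableSum hg hk hgbot hkbot) (separableSum_ne_bot hgbot hkbot) hzero
    hqualD
  rw [hx] at hu
  obtain ⟨hfst, hsnd⟩ := fst_snd_mem_limSubdiff_of_separableSum hg hk hgbot hkbot hu
  rw [hD, add_eq_zero_iff_eq_neg] at hDu
  exact ⟨u.snd, hsnd, hDu ▸ hfst⟩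

section Convex

variable {V : Type*} [NormedAddCommGroup V] [InnerProductSpace ℝ V] {k : V → EReal}

lemma add_inner_le_of_mem_frechetSubdiff (hbot : ∀ z, k z ≠ ⊥)
    (hconv : ConvexOn ℝ (edom k) fun z => (k z).toReal) {x p : V} (hp : p ∈ frechetSubdiff k x)
    (z : V) : k x + ((inner ℝ p (z - x) : ℝ) : EReal) ≤ k z := by
  by_cases hz : z ∈ edom k
  swap
  · rw [show k z = ⊤ by simpa [edom] using hz]
    exact le_top
  obtain ⟨r, hr⟩ := exists_real_of_mem_edom hbot hp.1
  obtain ⟨s, hs⟩ := exists_real_of_mem_edom hbot hz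
  have happrox : ∀ ε : ℝ, 0 < ε → r + inner ℝ p (z - x) ≤ s + ε * ‖z - x‖ := by
    intro ε hε
    have hlim : Tendsto (fun t : ℝ => AffineMap.lineMap x z t) (𝓝[>] 0) (𝓝 x) := by
      have hline := (AffineMap.lineMap_continuous (R := ℝ) (p := x) (q := z)).tendsto 0
      rw [AffineMap.lineMap_apply_zero] at hline
      exact hline.mono_left nhdsWithin_le_nhds
    obtain ⟨t, ht, ht0, ht1⟩ := ((hlim.eventually (hp.2 ε hε)).and (Ioo_mem_nhdsGT one_pos)).exists
    obtain ⟨q, hq⟩ := exists_real_of_mem_edom hbot (hconv.1.lineMap_mem hp.1 hz ⟨ht0.le, ht1.le⟩)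
    have hqconv := hconv.2 hp.1 hz (sub_nonneg.2 ht1.le) ht0.le (sub_add_cancel 1 t)
    rw [← AffineMap.lineMap_apply_module] at hqconv
    simp only [hq, hr, hs, EReal.toReal_coe, smul_eq_mul] at hqconv
    rw [hq, hr, AffineMap.lineMap_apply, vsub_eq_sub, vadd_eq_add, add_sub_cancel_right,
      inner_smul_right, norm_smul, Real.norm_of_nonneg ht0.le] at ht
    norm_cast at ht
    refine le_of_mul_le_mul_left ?_ ht0
    linarith
  have hlim : Tendsto (fun ε : ℝ => s + ε * ‖z - x‖) (𝓝[>] 0) (𝓝 (s + 0 * ‖z - x‖)) :=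
    (Continuous.tendsto (by fun_prop) 0).mono_left nhdsWithin_le_nhds
  rw [zero_mul, add_zero] at hlim
  rw [hr, hs]
  exact_mod_cast ge_of_tendsto hlim (eventually_mem_nhdsWithin.mono happrox)

lemma add_inner_le_of_mem_limSubdiff (hbot : ∀ z, k z ≠ ⊥)
    (hconv : ConvexOn ℝ (edom k) fun z => (k z).toReal) {x p : V} (hp : p ∈ limSubdiff k x)
    (z : V) : k x + ((inner ℝ p (z - x) : ℝ) : EReal) ≤ k z := by
  obtain ⟨-, y, w, hseq, hw⟩ := mem_limSubdiff_iff.1 hp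
  have hinner : Tendsto (fun n => ((inner ℝ (w n) (z - y n) : ℝ) : EReal)) atTop
      (𝓝 ((inner ℝ p (z - x) : ℝ) : EReal)) :=
    EReal.tendsto_coe.2 (hw.inner (tendsto_const_nhds.sub hseq.tendsto_point))
  have hsum := (EReal.continuousAt_add (p := (k x, ((inner ℝ p (z - x) : ℝ) : EReal)))
    (by simp) (by simp)).tendsto.comp (hseq.tendsto_value.prodMk_nhds hinner)
  exact le_of_tendsto hsum (Eventually.of_forall fun n =>
    add_inner_le_of_mem_frechetSubdiff hbot hconv (hseq.mem_frechetSubdiff n) z)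

lemma horizonSubdiff_subset_normalCone (hbot : ∀ z, k z ≠ ⊥)
    (hconv : ConvexOn ℝ (edom k) fun z => (k z).toReal) (x : V) :
    horizonSubdiff k x ⊆ normalCone (edom k) x := by
  intro v hv
  obtain ⟨hx, y, w, t, hseq, htpos, ht, htw⟩ := mem_horizonSubdiff_iff.1 hv
  obtain ⟨r, hr⟩ := exists_real_of_mem_edom hbot hx
  choose r' hr' using fun n => exists_real_of_mem_edom hbot (hseq.mem_frechetSubdiff n).1
  have hr'lim : Tendsto r' atTop (𝓝 r) := by
    rw [← EReal.tendsto_coe, ← hr]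
    exact hseq.tendsto_value.congr hr'
  have hnormal : ∀ z ∈ edom k, inner ℝ v (z - x) ≤ 0 := by
    intro z hz
    obtain ⟨s, hs⟩ := exists_real_of_mem_edom hbot hz
    have hle : ∀ n, inner ℝ (t n • w n) (z - y n) ≤ t n * (s - r' n) := fun n => by
      have hconvex := add_inner_le_of_mem_frechetSubdiff hbot hconv (hseq.mem_frechetSubdiff n) z
      rw [hr', hs] at hconvex
      norm_cast at hconvex
      rw [real_inner_smul_left]
      exact mul_le_mul_of_nonneg_left (by linarith) (htpos n).le
    have hright : Tendsto (fun n => t n * (s - r' n)) atTop (𝓝 (0 * (s - r))) :=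
      ht.mul (tendsto_const_nhds.sub hr'lim)
    rw [zero_mul] at hright
    exact le_of_tendsto_of_tendsto' (htw.inner (tendsto_const_nhds.sub hseq.tendsto_point)) hright
      hle
  refine ⟨hx, fun _ => x, fun _ => v, tendsto_const_nhds, fun _ => ⟨hx, fun ε hε => ?_⟩,
    tendsto_const_nhds⟩
  filter_upwards [self_mem_nhdsWithin] with z hz
  exact (hnormal z hz).trans (by positivity)

end Convex

section Openness

variable {E G : Type*} [NormedAddCommGroup E] [InnerProductSpace ℝ E] [ProperSpace E]
  [NormedAddCommGroup G] [InnerProductSpace ℝ G] {J : E → EReal} {B : E →L[ℝ] G} {z₀ : E}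

omit [InnerProductSpace ℝ E] in
lemma exists_isLocalMin_add_mem_ball (hJ : LowerSemicontinuous J) {φ : E → ℝ} (hφ : Continuous φ)
    {r δ ε : ℝ} (hr : J z₀ = r) (hδ : 0 < δ)
    (hlow : ∀ z ∈ Metric.closedBall z₀ δ, ((r - ε : ℝ) : EReal) < J z) (hφ0 : ∀ z, 0 ≤ φ z)
    (hφz₀ : φ z₀ < ε) (hsphere : ∀ z ∈ Metric.sphere z₀ δ, 2 * ε ≤ φ z) :
    ∃ z ∈ Metric.ball z₀ δ, ∃ s : ℝ, J z = s ∧ |s - r| ≤ ε ∧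
      IsLocalMin (fun z => J z + (φ z : EReal)) z := by
  obtain ⟨z, hz, hmin⟩ :=
    ((lowerSemicontinuous_add_coe hJ hφ).lowerSemicontinuousOn _).exists_isMinOn
    ⟨z₀, Metric.mem_closedBall_self hδ.le⟩ (isCompact_closedBall z₀ δ)
  have hle : J z + (φ z : EReal) ≤ J z₀ + (φ z₀ : EReal) := hmin (Metric.mem_closedBall_self hδ.le)
  have hrz := hlow z hz
  have hztop : J z ≠ ⊤ := fun htop => by simp [htop, hr, ← EReal.coe_add] at hle
  obtain ⟨s, hs⟩ : ∃ s : ℝ, J z = s :=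
    ⟨_, (EReal.coe_toReal hztop ((bot_le.trans_lt hrz).ne')).symm⟩
  rw [hs] at hrz
  rw [hs, hr] at hle
  norm_cast at hle hrz
  have hzball : z ∈ Metric.ball z₀ δ := by
    refine (Metric.mem_closedBall.1 hz).lt_of_ne fun hdist => ?_
    linarith [hsphere z hdist]
  exact ⟨z, hzball, s, hs, abs_le.2 ⟨by linarith, by linarith [hφ0 z]⟩,
    hmin.isLocalMin (Metric.closedBall_mem_nhds_of_mem hzball)⟩

lemma norm_inv_smul_add_adjoint_le [CompleteSpace G] {n κ δ ε : ℝ} {z : E} {d : G} (hn : 0 < n)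
    (hκ : 0 ≤ κ) (hz : ‖z - z₀‖ ≤ δ) (hnκ : 2 * κ * δ ≤ n * ε) :
    ‖n⁻¹ • -(B.adjoint (n • d) + κ • (2 : ℝ) • (z - z₀)) + B.adjoint d‖ ≤ ε := by
  have hsum : n⁻¹ • -(B.adjoint (n • d) + κ • (2 : ℝ) • (z - z₀)) + B.adjoint d =
      -((2 * κ / n) • (z - z₀)) := by
    rw [map_smul, smul_neg, smul_add, inv_smul_smul₀ hn.ne']
    module
  rw [hsum, norm_neg, norm_smul, Real.norm_of_nonneg (by positivity), div_mul_eq_mul_div,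
    div_le_iff₀' hn]
  exact le_trans (by gcongr) hnκ

/-- Minimizing `J z + n‖B z - g‖ + κ‖z - z₀‖²` for a missing value `g` close to `B z₀`: the penalty
is differentiable on `dom J`, and dividing the optimality condition by the large parameter `n`
leaves only the direction `d` of `B z - g`. -/
lemma exists_norm_smul_add_adjoint_le_of_notMem_nhds [CompleteSpace G]
    (hJ : LowerSemicontinuous J) {r : ℝ} (hr : J z₀ = r)
    (himage : B '' edom J ∉ 𝓝 (B z₀)) {ε : ℝ} (hε : 0 < ε) :
    ∃ z u d, ∃ s t : ℝ, J z = s ∧ u ∈ frechetSubdiff J z ∧ ‖z - z₀‖ ≤ ε ∧ |s - r| ≤ ε ∧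
      ‖d‖ = 1 ∧ 0 < t ∧ t ≤ ε ∧ ‖t • u + B.adjoint d‖ ≤ ε := by
  obtain ⟨δ, hδ, hball⟩ := Metric.nhds_basis_closedBall.mem_iff.1
    ((eventually_coe_sub_lt hJ hr hε).and (Metric.closedBall_mem_nhds _ hε))
  set κ : ℝ := 2 * ε / δ ^ 2
  have hκδ : κ * δ ^ 2 = 2 * ε := div_mul_cancel₀ _ (by positivity)
  set n : ℝ := max (1 / ε) (2 * κ * δ / ε)
  have hn : 0 < n := lt_max_of_lt_left (by positivity)
  obtain ⟨g, hgimage, hg⟩ : ∃ g, g ∉ B '' edom J ∧ n * ‖-g + B z₀‖ < ε := by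
    have hlim : Tendsto (fun g => n * ‖-g + B z₀‖) (𝓝 (B z₀)) (𝓝 (n * ‖-(B z₀) + B z₀‖)) :=
      Continuous.tendsto (by fun_prop) _
    exact ((show ∃ᶠ g in 𝓝 (B z₀), g ∉ B '' edom J by
      simpa only [Filter.Frequently, not_not, eventually_mem_set] using himage).and_eventually
      (hlim.eventually_lt_const (by simpa using hε))).exists
  obtain ⟨z, hzball, s, hs, hsr, hmin⟩ := exists_isLocalMin_add_mem_ball hJ
    (φ := fun z => n * ‖-g + B z‖ + κ * ‖z - z₀‖ ^ 2) (by fun_prop) hr hδ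
    (fun z hz => (hball hz).1) (fun z => by positivity) (by simpa using hg) fun z hz => by
      rw [mem_sphere_iff_norm.1 hz, hκδ]
      exact le_add_of_nonneg_left (by positivity)
  have hne : -g + B z ≠ 0 := fun hzero =>
    hgimage ⟨z, mem_edom_of_eq_coe hs, (neg_add_eq_zero.1 hzero).symm⟩
  have hu := neg_mem_frechetSubdiff_of_isLocalMin_add (mem_edom_of_eq_coe hs)
    (hasGradientAt_add (hasGradientAt_comp_affine (hasGradientAt_const_mul n
      (hasGradientAt_norm hne))) (hasGradientAt_const_mul κ (hasGradientAt_norm_sub_sq z₀ z))) hmin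
  exact ⟨z, _, ‖-g + B z‖⁻¹ • (-g + B z), s, n⁻¹, hs, hu,
    mem_closedBall_iff_norm.1 (hball (Metric.ball_subset_closedBall hzball)).2, hsr,
    norm_smul_inv_norm (𝕜 := ℝ) hne, inv_pos.2 hn,
    inv_le_of_inv_le₀ hε ((one_div ε).symm.le.trans (le_max_left _ _)),
    norm_inv_smul_add_adjoint_le hn (by positivity) (mem_ball_iff_norm.1 hzball).le
      ((div_le_iff₀ hε).1 (le_max_right _ _))⟩

lemma image_edom_mem_nhds [ProperSpace G] (hJ : LowerSemicontinuous J) (hbot : ∀ z, J z ≠ ⊥)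
    (hz₀ : z₀ ∈ edom J) (hqual : ∀ v, B.adjoint v ∈ horizonSubdiff J z₀ → v = 0) :
    B '' edom J ∈ 𝓝 (B z₀) := by
  by_contra himage
  obtain ⟨r, hr⟩ := exists_real_of_mem_edom hbot hz₀
  choose z u d s t hs hu hz hsr hd htpos ht htu using fun n : ℕ =>
    exists_norm_smul_add_adjoint_le_of_notMem_nhds hJ hr himage
      (Nat.one_div_pos_of_nat (n := n) (α := ℝ))
  have hε : Tendsto (fun n : ℕ => 1 / ((n : ℝ) + 1)) atTop (𝓝 0) :=
    tendsto_one_div_add_atTop_nhds_zero_nat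
  have hseq : IsSubgradientSeq J z₀ z u := by
    refine ⟨tendsto_iff_norm_sub_tendsto_zero.2 (squeeze_zero (fun n => norm_nonneg _) hz hε),
      ?_, hu⟩
    simpa only [hr, hs, EReal.tendsto_coe] using
      tendsto_iff_dist_tendsto_zero.2 (squeeze_zero (fun n => dist_nonneg) hsr hε)
  have hsphere : ∀ n, d n ∈ Metric.sphere (0 : G) 1 := fun n => by simp [hd n]
  obtain ⟨v, hv, ψ, hψ, hlim⟩ := (isCompact_sphere (0 : G) 1).tendsto_subseq hsphere
  have hsum : Tendsto (fun n => t n • u n + B.adjoint (d n)) atTop (𝓝 0) :=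
    tendsto_zero_iff_norm_tendsto_zero.2 (squeeze_zero (fun n => norm_nonneg _) htu hε)
  have hBd : Tendsto (fun n => B.adjoint (d (ψ n))) atTop (𝓝 (B.adjoint v)) :=
    (B.adjoint.continuous.tendsto v).comp hlim
  have htulim : Tendsto (fun n => t (ψ n) • u (ψ n)) atTop (𝓝 (B.adjoint (-v))) := by
    simpa using (hsum.comp hψ.tendsto_atTop).sub hBd
  have htlim : Tendsto t atTop (𝓝 0) := squeeze_zero (fun n => (htpos n).le) ht hε
  have hzero := hqual (-v) ((hseq.comp_strictMono hψ).mem_horizonSubdiff hz₀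
    (fun n => htpos _) (htlim.comp hψ.tendsto_atTop) htulim)
  simp [neg_eq_zero.1 hzero] at hv

end Openness

section PartialSubgradients

variable {E : Type*} [NormedAddCommGroup E] [InnerProductSpace ℝ E] [FiniteDimensional ℝ E]
  {J : WithLp 2 (E × E) → EReal} {x y : E}

lemma exists_toLp_mem_limSubdiff_of_snd (hJ : LowerSemicontinuous J) (hbot : ∀ z, J z ≠ ⊥) {w : E}
    (hw : w ∈ limSubdiff (fun y => J (WithLp.toLp 2 (x, y))) y)
    (hqual : ∀ v, WithLp.toLp 2 (v, 0) ∈ horizonSubdiff J (WithLp.toLp 2 (x, y)) → v = 0) :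
    ∃ v, WithLp.toLp 2 (v, w) ∈ limSubdiff J (WithLp.toLp 2 (x, y)) := by
  rw [show (fun y => J (WithLp.toLp 2 (x, y))) = fun y =>
    J (WithLp.toLp 2 (x, 0) + toLpProd 0 (.id ℝ E) y) by
      simp only [toLp_add_toLpProd_zero_id]] at hw
  obtain ⟨u, hu, rfl⟩ := exists_mem_limSubdiff_adjoint_eq hJ hbot hw fun u hu hsnd => by
    rw [toLp_add_toLpProd_zero_id] at hu
    rw [adjoint_toLpProd_zero_id] at hsnd
    have hueq : u = WithLp.toLp 2 (u.fst, 0) := by rw [← hsnd]; rfl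
    rw [hueq] at hu
    rw [hueq, hqual _ hu]
    rfl
  rw [toLp_add_toLpProd_zero_id] at hu
  exact ⟨u.fst, by rwa [adjoint_toLpProd_zero_id]⟩

lemma exists_toLp_mem_limSubdiff_of_fst (hJ : LowerSemicontinuous J) (hbot : ∀ z, J z ≠ ⊥) {v : E}
    (hv : v ∈ limSubdiff (fun x => J (WithLp.toLp 2 (x, y))) x)
    (hqual : ∀ w, WithLp.toLp 2 (0, w) ∈ horizonSubdiff J (WithLp.toLp 2 (x, y)) → w = 0) :
    ∃ w, WithLp.toLp 2 (v, w) ∈ limSubdiff J (WithLp.toLp 2 (x, y)) := by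
  rw [show (fun x => J (WithLp.toLp 2 (x, y))) = fun x =>
    J (WithLp.toLp 2 (0, y) + toLpProd (.id ℝ E) 0 x) by
      simp only [toLp_zero_add_toLpProd_id]] at hv
  obtain ⟨u, hu, rfl⟩ := exists_mem_limSubdiff_adjoint_eq hJ hbot hv fun u hu hfst => by
    rw [toLp_zero_add_toLpProd_id] at hu
    rw [adjoint_toLpProd_id_zero] at hfst
    have hueq : u = WithLp.toLp 2 (0, u.snd) := by rw [← hfst]; rfl
    rw [hueq] at hu
    rw [hueq, hqual _ hu]
    rfl
  rw [toLp_zero_add_toLpProd_id] at hu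
  exact ⟨u.snd, by rwa [adjoint_toLpProd_id_zero]⟩

end PartialSubgradients

section SubgradientBound

variable {V : Type*} [NormedAddCommGroup V] [InnerProductSpace ℝ V] {g : V → EReal}

lemma eventually_add_mul_inner_sub_le {u w : V} (hw : w ∈ frechetSubdiff g u) (d : V) {ε : ℝ}
    (hε : 0 < ε) : ∀ᶠ t in 𝓝[>] (0 : ℝ),
      g u + ((t * (inner ℝ w d - ε) : ℝ) : EReal) ≤ g (u + t • d) := by
  have hlim : Tendsto (fun t : ℝ => u + t • d) (𝓝[>] 0) (𝓝 u) := by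
    have hline : Tendsto (fun t : ℝ => u + t • d) (𝓝 0) (𝓝 (u + (0 : ℝ) • d)) :=
      Continuous.tendsto (by fun_prop) 0
    simpa using hline.mono_left nhdsWithin_le_nhds
  filter_upwards [hlim.eventually (hw.2 (ε / (‖d‖ + 1)) (by positivity)), self_mem_nhdsWithin]
    with t ht (ht0 : 0 < t)
  refine le_trans ?_ ht
  have hnorm : ε / (‖d‖ + 1) * ‖t • d‖ ≤ t * ε := by
    rw [norm_smul, Real.norm_of_nonneg ht0.le, div_mul_eq_mul_div, div_le_iff₀ (by positivity)]
    nlinarith [mul_pos hε ht0]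
  rw [add_sub_cancel_left, inner_smul_right, mul_sub]
  gcongr

lemma norm_le_of_mem_frechetSubdiff_of_le_add {y w : V} {r R : ℝ} (hr : g y = r) (hR : 0 ≤ R)
    (hle : ∀ᶠ z in 𝓝 y, g z ≤ ((r + R * ‖z - y‖ : ℝ) : EReal)) (hw : w ∈ frechetSubdiff g y) :
    ‖w‖ ≤ R := by
  rcases eq_or_ne w 0 with rfl | hne
  · rwa [norm_zero]
  have hpos : 0 < ‖w‖ := norm_pos_iff.2 hne
  refine le_of_forall_pos_le_add fun ε hε => ?_
  have hlim : Tendsto (fun t : ℝ => y + t • w) (𝓝[>] 0) (𝓝 y) := by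
    have hline : Tendsto (fun t : ℝ => y + t • w) (𝓝 0) (𝓝 (y + (0 : ℝ) • w)) :=
      Continuous.tendsto (by fun_prop) 0
    simpa using hline.mono_left nhdsWithin_le_nhds
  obtain ⟨t, ⟨hlow, hup⟩, ht : 0 < t⟩ := (((eventually_add_mul_inner_sub_le hw w
    (mul_pos hε hpos)).and (hlim.eventually hle)).and self_mem_nhdsWithin).exists
  have hslope := hlow.trans hup
  rw [hr, add_sub_cancel_left, norm_smul, Real.norm_of_nonneg ht.le,
    real_inner_self_eq_norm_sq] at hslope
  norm_cast at hslope
  refine le_of_mul_le_mul_left ?_ (mul_pos ht hpos)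
  linarith

/-- Along the segment from `z` to `y` the function `-φ` has upper right derivative at most
`R‖y - z‖`. -/
lemma le_add_mul_norm_sub_of_forall_exists_mem_frechetSubdiff {s : Set V} (hs : Convex ℝ s)
    {φ : V → ℝ} (hφ : ContinuousOn φ s) (hgφ : ∀ u ∈ s, g u = φ u) {R : ℝ}
    (hsub : ∀ u ∈ s, ∃ w ∈ frechetSubdiff g u, ‖w‖ ≤ R) {y z : V} (hy : y ∈ s) (hz : z ∈ s) :
    φ z ≤ φ y + R * ‖z - y‖ := by
  set γ : ℝ → V := fun t => z + t • (y - z) with hγ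
  have hγs : ∀ t ∈ Icc (0 : ℝ) 1, γ t ∈ s := fun t ht => hs.add_smul_sub_mem hz hy ht
  have hγadd : ∀ t a : ℝ, γ (t + a) = γ t + a • (y - z) := fun t a => by
    simp only [hγ]
    module
  have hcont : ContinuousOn (fun t => -φ (γ t)) (Icc 0 1) :=
    (hφ.comp (by fun_prop) hγs).neg
  have hslope : ∀ t ∈ Ico (0 : ℝ) 1, ∀ K, R * ‖y - z‖ < K →
      ∃ᶠ t' in 𝓝[>] t, slope (fun t => -φ (γ t)) t t' < K := by
    intro t ht K hK
    obtain ⟨w, hw, hwR⟩ := hsub _ (hγs t (Ico_subset_Icc_self ht))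
    have hinner : -(R * ‖y - z‖) ≤ inner ℝ w (y - z) := by
      have hcs := neg_le_of_abs_le (abs_real_inner_le_norm w (y - z))
      exact le_trans (by gcongr) hcs
    have hev : ∀ᶠ a in 𝓝[>] (0 : ℝ), slope (fun t => -φ (γ t)) t (t + a) < K := by
      filter_upwards [eventually_add_mul_inner_sub_le hw (y - z) (half_pos (sub_pos.2 hK)),
        Ioo_mem_nhdsGT (sub_pos.2 ht.2)] with a ha ⟨ha0, ha1⟩
      rw [← hγadd, hgφ _ (hγs t (Ico_subset_Icc_self ht)),
        hgφ _ (hγs (t + a) ⟨add_nonneg ht.1 ha0.le, by linarith⟩)] at ha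
      norm_cast at ha
      rw [slope_def_field, add_sub_cancel_left, div_lt_iff₀ ha0]
      nlinarith
    have hfreq := hev.frequently
    rw [← add_zero t, ← Filter.map_add_left_nhdsGT, frequently_map]
    simpa only [add_zero] using hfreq
  have hbound := image_le_of_liminf_slope_right_le_deriv_boundary hcont
    (B := fun t => -φ z + t * (R * ‖y - z‖)) (B' := fun _ => R * ‖y - z‖) (by simp [hγ])
    (by fun_prop)
    (fun t _ => by
      simpa using (((hasDerivAt_id t).mul_const (R * ‖y - z‖)).const_add (-φ z)).hasDerivWithinAt)
    hslope (right_mem_Icc.2 zero_le_one)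
  simp only [hγ, one_smul, add_sub_cancel, one_mul, norm_sub_rev y] at hbound
  linarith

end SubgradientBound

section Model

variable {f h : Euc N → EReal} {m : Euc N → Euc N → EReal} {Lu Ll : ℝ}

lemma ModelAssumption.model_ne_bot (hm : ModelAssumption f h m Lu Ll) (x y : Euc N) :
    m x y ≠ ⊥ :=
  hm.joint_proper.1 (WithLp.toLp 2 (x, y))

lemma ModelAssumption.model_lt_top (hm : ModelAssumption f h m Lu Ll) {x y : Euc N}
    (hx : x ∈ edom f) (hy : y ∈ edom f) : m x y < ⊤ :=
  (hm.joint_dom y hy).ge hx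

lemma ModelAssumption.exists_model_eq_coe (hm : ModelAssumption f h m Lu Ll) {x y : Euc N}
    (hx : x ∈ edom f) (hy : y ∈ edom f) : ∃ r : ℝ, m x y = r :=
  ⟨_, (EReal.coe_toReal (hm.model_lt_top hx hy).ne (hm.model_ne_bot x y)).symm⟩

lemma ModelAssumption.continuousOn_toReal_model (hm : ModelAssumption f h m Lu Ll) {x : Euc N}
    (hx : x ∈ edom f) : ContinuousOn (fun y => (m x y).toReal) (edom f) := by
  have hcont : ContinuousOn (fun y => m x y) (edom f) :=
    hm.joint_cont.comp (f := fun y => (WithLp.toLp 2 (x, y) : Euc2 N)) (by fun_prop)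
      fun y hy => ⟨hx, hy⟩
  exact EReal.continuousOn_toReal.comp hcont fun y hy =>
    by simpa [hm.model_ne_bot x y] using (hm.model_lt_top hx hy).ne

lemma isOpen_edom_of_horizonAndRegular (hm : ModelAssumption f h m Lu Ll)
    (hHR : HorizonAndRegular f m) : IsOpen (edom f) := by
  refine isOpen_iff_mem_nhds.2 fun x hx => ?_
  have himage := image_edom_mem_nhds (B := WithLp.fstL 2 ℝ (Euc N) (Euc N)) hm.joint_lsc
    hm.joint_proper.1 (z₀ := WithLp.toLp 2 (x, x)) (hm.model_lt_top hx hx) fun v hv => by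
      rw [adjoint_fstL] at hv
      exact (hHR x hx x hx).2.1 v hv
  filter_upwards [himage] with x' hx'
  obtain ⟨z, hz, rfl⟩ := hx'
  exact hm.joint_dom_subset z.fst z.snd hz

lemma mem_frechetSubdiff_of_mem_limSubdiff (hm : ModelAssumption f h m Lu Ll)
    (hHR : HorizonAndRegular f m) {x y w : Euc N} (hx : x ∈ edom f) (hy : y ∈ edom f)
    (hw : w ∈ limSubdiff (m x) y) : w ∈ frechetSubdiff (m x) y := by
  obtain ⟨v, hv⟩ := exists_toLp_mem_limSubdiff_of_snd hm.joint_lsc hm.joint_proper.1 hw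
    (hHR x hx y hy).2.1
  exact snd_mem_frechetSubdiff
    ((hHR x hx y hy).2.2.limSubdiff_subset hm.joint_proper.1 hv)

lemma exists_mem_limSubdiff_of_subdiffNorm_le {V : Type*} [NormedAddCommGroup V]
    [InnerProductSpace ℝ V] {g : V → EReal} {y : V} {c ε : ℝ} (hc : 0 ≤ c) (hε : 0 < ε)
    (h : subdiffNorm g y ≤ ENNReal.ofReal c) : ∃ w ∈ limSubdiff g y, ‖w‖ ≤ c + ε := by
  have hlt : subdiffNorm g y < ENNReal.ofReal (c + ε) :=
    h.trans_lt ((ENNReal.ofReal_lt_ofReal_iff (by positivity)).2 (by linarith))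
  simp only [subdiffNorm, iInf_lt_iff, exists_prop] at hlt
  obtain ⟨w, hw, hwlt⟩ := hlt
  rw [← ofReal_norm, ENNReal.ofReal_lt_ofReal_iff (by positivity)] at hwlt
  exact ⟨w, hw, hwlt.le⟩

/-- Small subgradients near `y` make `m x` Lipschitz there, and a Lipschitz bound controls
every Fréchet subgradient. -/
lemma norm_le_of_mem_frechetSubdiff_snd (hm : ModelAssumption f h m Lu Ll)
    (hHR : HorizonAndRegular f m) {U : Set (Euc N)} (hU : IsOpen U) {c : ℝ} (hc : 0 < c)
    (hrel : ∀ x ∈ edom f ∩ U, ∀ y ∈ edom f ∩ U,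
      subdiffNorm (m x) y ≤ ENNReal.ofReal (c * ‖x - y‖)) {x y w : Euc N}
    (hx : x ∈ edom f ∩ U) (hy : y ∈ edom f ∩ U) (hw : w ∈ frechetSubdiff (m x) y) :
    ‖w‖ ≤ c * ‖x - y‖ := by
  obtain ⟨δ₀, hδ₀, hsub⟩ := Metric.isOpen_iff.1
    ((isOpen_edom_of_horizonAndRegular hm hHR).inter hU) y hy
  refine le_of_forall_pos_le_add fun ε hε => ?_
  set δ := min δ₀ (ε / (2 * c))
  have hδ : 0 < δ := by positivity
  have hcδ : c * δ ≤ ε / 2 := by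
    have hle : δ ≤ ε / (2 * c) := min_le_right _ _
    rw [le_div_iff₀ (by positivity)] at hle
    linarith
  have hball : Metric.ball y δ ⊆ edom f ∩ U :=
    (Metric.ball_subset_ball (min_le_left _ _)).trans hsub
  have hcoe : ∀ u ∈ Metric.ball y δ, m x u = ((m x u).toReal : ℝ) := fun u hu =>
    (EReal.coe_toReal (hm.model_lt_top hx.1 (hball hu).1).ne (hm.model_ne_bot x u)).symm
  have hsmall : ∀ u ∈ Metric.ball y δ,
      ∃ w ∈ frechetSubdiff (m x) u, ‖w‖ ≤ c * ‖x - y‖ + ε := fun u hu => by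
    obtain ⟨w, hw, hle⟩ := exists_mem_limSubdiff_of_subdiffNorm_le (by positivity)
      (half_pos hε) (hrel x hx u (hball hu))
    refine ⟨w, mem_frechetSubdiff_of_mem_limSubdiff hm hHR hx.1 (hball hu).1 hw, hle.trans ?_⟩
    have hyu : ‖y - u‖ < δ := by rw [norm_sub_rev]; exact mem_ball_iff_norm.1 hu
    have htri : ‖x - u‖ ≤ ‖x - y‖ + ‖y - u‖ := norm_sub_le_norm_sub_add_norm_sub x y u
    nlinarith
  refine norm_le_of_mem_frechetSubdiff_of_le_add (hcoe y (Metric.mem_ball_self hδ))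
    (by positivity) ?_ hw
  filter_upwards [Metric.ball_mem_nhds y hδ] with z hz
  rw [hcoe z hz]
  exact_mod_cast le_add_mul_norm_sub_of_forall_exists_mem_frechetSubdiff (convex_ball y δ)
    ((hm.continuousOn_toReal_model hx.1).mono fun u hu => (hball hu).1) hcoe hsmall
    (Metric.mem_ball_self hδ) hz

lemma exists_toLp_mem_limSubdiff_joint_norm_le (hm : ModelAssumption f h m Lu Ll)
    {U : Set (Euc N)} (hU : IsOpen U) {c : ℝ} (hc : 0 < c)
    (hrel : ∀ x ∈ edom f ∩ U, ∀ y ∈ edom f ∩ U,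
      subdiffNorm (m x) y ≤ ENNReal.ofReal (c * ‖x - y‖)) {x y v : Euc N}
    (hx : x ∈ edom f ∩ U) (hy : y ∈ edom f ∩ U)
    (hv : v ∈ limSubdiff (fun x' => m x' y) x) {ε : ℝ} (hε : 0 < ε) :
    ∃ w : Euc N, WithLp.toLp 2 (v, w) ∈ limSubdiff (joint m) (WithLp.toLp 2 (x, y)) ∧
      ‖w‖ ≤ c * ‖x - y‖ + ε := by
  rcases hm.joint_subdiff with hHR | hsep
  · obtain ⟨w, hw⟩ := exists_toLp_mem_limSubdiff_of_fst hm.joint_lsc hm.joint_proper.1 hv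
      (hHR x hx.1 y hy.1).1
    have hfre : w ∈ frechetSubdiff (m x) y := snd_mem_frechetSubdiff
      ((hHR x hx.1 y hy.1).2.2.limSubdiff_subset hm.joint_proper.1 hw)
    exact ⟨w, hw, (norm_le_of_mem_frechetSubdiff_snd hm hHR hU hc hrel hx hy hfre).trans
      (le_add_of_nonneg_right hε.le)⟩
  · obtain ⟨w, hw, hle⟩ := exists_mem_limSubdiff_of_subdiffNorm_le (by positivity) hε
      (hrel x hx y hy)
    exact ⟨w, (hsep x hx.1 y hy.1).1.ge ⟨hv, hw⟩, hle⟩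

end Model

section Legendre

lemma mul_norm_le_of_forall_inner_le {V : Type*} [NormedAddCommGroup V] [InnerProductSpace ℝ V]
    {G : V} {ρ C : ℝ} (hρ : 0 ≤ ρ) (hle : ∀ d, ‖d‖ ≤ ρ → inner ℝ G d ≤ C) : ρ * ‖G‖ ≤ C := by
  rcases eq_or_ne G 0 with rfl | hG
  · simpa using hle 0 (by simpa using hρ)
  have hG' : ‖G‖ ≠ 0 := norm_ne_zero_iff.2 hG
  have hd : ‖(ρ / ‖G‖) • G‖ ≤ ρ := by
    rw [norm_smul, Real.norm_of_nonneg (by positivity), div_mul_cancel₀ _ hG']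
  calc ρ * ‖G‖ = inner ℝ G ((ρ / ‖G‖) • G) := by
        rw [inner_smul_right, real_inner_self_eq_norm_sq]
        field_simp
    _ ≤ C := hle _ hd

variable {h : Euc N → EReal}

lemma hasGradientAt_grad (hL : IsLegendre h) {y : Euc N} (hy : y ∈ interior (edom h)) :
    HasGradientAt (fun z => (h z).toReal) (grad h y) y :=
  ((hL.differentiableOn y hy).differentiableAt (isOpen_interior.mem_nhds hy)).hasGradientAt

lemma coe_toReal_of_mem_edom (hL : IsLegendre h) {x : Euc N} (hx : x ∈ edom h) :
    ((h x).toReal : EReal) = h x :=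
  EReal.coe_toReal (ne_of_lt hx) (hL.proper.1 x)

lemma grad_mem_frechetSubdiff (hL : IsLegendre h) {y : Euc N} (hy : y ∈ interior (edom h)) :
    grad h y ∈ frechetSubdiff h y := by
  have hzero : (0 : Euc N) ∈ frechetSubdiff (fun _ : Euc N => (0 : EReal)) y :=
    zero_mem_frechetSubdiff EReal.zero_lt_top (Eventually.of_forall fun _ => le_rfl)
  rw [← zero_add (grad h y)]
  refine add_mem_frechetSubdiff hzero (hasGradientAt_grad hL hy) ?_
  filter_upwards [isOpen_interior.mem_nhds hy] with z hz
  rw [zero_add, coe_toReal_of_mem_edom hL (interior_subset hz)]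

lemma toReal_add_inner_grad_le (hL : IsLegendre h) {y z : Euc N}
    (hy : y ∈ interior (edom h)) (hz : z ∈ edom h) :
    (h y).toReal + inner ℝ (grad h y) (z - y) ≤ (h z).toReal := by
  have hle := add_inner_le_of_mem_frechetSubdiff hL.proper.1 hL.convexOn
    (grad_mem_frechetSubdiff hL hy) z
  rw [← coe_toReal_of_mem_edom hL (interior_subset hy), ← coe_toReal_of_mem_edom hL hz] at hle
  exact_mod_cast hle

/-- Monotonicity of the subgradients between `x` and `y` bounds `⟨∇h(y), a - x⟩` from below,
so the gradient inequality at `y`, tested on the ball around `a`, bounds `∇h(y)`. -/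
lemma mul_norm_grad_add_smul_le (hL : IsLegendre h) {x p a : Euc N} (hx : x ∈ edom h)
    (hp : ∀ z ∈ edom h, (h x).toReal + inner ℝ p (z - x) ≤ (h z).toReal) {ρ M : ℝ} (hρ : 0 ≤ ρ)
    (hball : Metric.closedBall a ρ ⊆ edom h)
    (hM : ∀ z ∈ Metric.closedBall a ρ, (h z).toReal ≤ M) {t : ℝ} (ht : t ∈ Ioo (0 : ℝ) 1)
    (hmem : x + t • (a - x) ∈ interior (edom h)) :
    ρ * ‖grad h (x + t • (a - x))‖ ≤ M - (h x).toReal + 2 * |inner ℝ p (a - x)| := by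
  set y := x + t • (a - x) with hy
  have hlow : (h x).toReal + t * inner ℝ p (a - x) ≤ (h y).toReal := by
    simpa [hy, inner_smul_right] using hp y (interior_subset hmem)
  have hmono : inner ℝ p (a - x) ≤ inner ℝ (grad h y) (a - x) := by
    have hup := toReal_add_inner_grad_le hL hmem hx
    rw [show x - y = -(t • (a - x)) by rw [hy]; abel, inner_neg_right, inner_smul_right] at hup
    exact le_of_mul_le_mul_left (by linarith) ht.1
  refine mul_norm_le_of_forall_inner_le hρ fun d hd => ?_
  have had : a + d ∈ Metric.closedBall a ρ := by simpa [dist_eq_norm] using hd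
  have htest := toReal_add_inner_grad_le hL hmem (hball had)
  rw [show a + d - y = (1 - t) • (a - x) + d by rw [hy]; module, inner_add_right,
    inner_smul_right] at htest
  have hscaled : (1 - t) * inner ℝ p (a - x) ≤ (1 - t) * inner ℝ (grad h y) (a - x) :=
    mul_le_mul_of_nonneg_left hmono (by linarith [ht.2])
  have habs := neg_abs_le (inner ℝ p (a - x))
  linarith [hM _ had, abs_nonneg (inner ℝ p (a - x))]

/-- Otherwise the gradient would stay bounded along a segment from the interior to a boundary
point, against essential smoothness. -/
lemma domConvexSubdiff_subset_interior (hL : IsLegendre h) :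
    domConvexSubdiff h ⊆ interior (edom h) := by
  rintro x ⟨hxd, p, hp⟩
  by_contra hx
  have hpreal : ∀ z ∈ edom h, (h x).toReal + inner ℝ p (z - x) ≤ (h z).toReal := fun z hz => by
    have hle := hp z
    rw [← coe_toReal_of_mem_edom hL hxd, ← coe_toReal_of_mem_edom hL hz] at hle
    exact_mod_cast hle
  obtain ⟨a, ha⟩ := hL.interior_nonempty
  obtain ⟨ρ, hρ, hball⟩ := Metric.nhds_basis_closedBall.mem_iff.1 (isOpen_interior.mem_nhds ha)
  obtain ⟨M, hM⟩ := (isCompact_closedBall a ρ).bddAbove_image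
    (hL.differentiableOn.continuousOn.mono hball)
  have hpath : ∀ t ∈ Ioo (0 : ℝ) 1, x + t • (a - x) ∈ interior (edom h) := fun t ht =>
    hL.convexOn.1.add_smul_sub_mem_interior hxd ha ⟨ht.1, ht.2.le⟩
  have hIoo : ∀ᶠ t in 𝓝[>] (0 : ℝ), t ∈ Ioo (0 : ℝ) 1 := Ioo_mem_nhdsGT one_pos
  have hlim : Tendsto (fun t : ℝ => x + t • (a - x)) (𝓝[>] 0) (𝓝[interior (edom h)] x) := by
    refine tendsto_nhdsWithin_iff.2 ⟨?_, hIoo.mono hpath⟩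
    have hline : Tendsto (fun t : ℝ => x + t • (a - x)) (𝓝 0) (𝓝 (x + (0 : ℝ) • (a - x))) :=
      Continuous.tendsto (by fun_prop) 0
    simpa using hline.mono_left nhdsWithin_le_nhds
  have hsteep := ((hL.steep x ⟨subset_closure hxd, hx⟩).comp hlim).eventually_gt_atTop
    ((M - (h x).toReal + 2 * |inner ℝ p (a - x)|) / ρ)
  obtain ⟨t, hlarge, ht⟩ := (hsteep.and hIoo).exists
  rw [Function.comp_apply, div_lt_iff₀' hρ] at hlarge
  exact hlarge.not_ge (mul_norm_grad_add_smul_le hL hxd hpreal hρ.le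
    (hball.trans interior_subset) (fun z hz => hM (mem_image_of_mem _ hz)) ht (hpath t ht))

end Legendre

section Bregman

/-- The Bregman distance as a real-valued function; it agrees with `bregman` on
`dom h × int dom h` only. -/
def bregmanReal (h : Euc N → EReal) (x y : Euc N) : ℝ :=
  (h x).toReal - (h y).toReal - inner ℝ (grad h y) (x - y)

variable {h : Euc N → EReal}

lemma bregman_eq_coe (hL : IsLegendre h) {x y : Euc N} (hx : x ∈ edom h)
    (hy : y ∈ interior (edom h)) : bregman h x y = (bregmanReal h x y : ℝ) := by
  rw [bregman, if_pos hy, bregmanReal, ← coe_toReal_of_mem_edom hL hx, EReal.toReal_coe,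
    ← EReal.coe_sub, sub_sub]

lemma bregman_eq_top {x y : Euc N} (hx : x ∉ edom h) : bregman h x y = ⊤ := by
  have htop : h x = ⊤ := by simpa [edom] using hx
  rw [bregman, htop, EReal.top_sub_coe, ite_self]

lemma bregmanReal_self (x : Euc N) : bregmanReal h x x = 0 := by simp [bregmanReal]

lemma bregmanReal_nonneg (hL : IsLegendre h) {x y : Euc N} (hx : x ∈ edom h)
    (hy : y ∈ interior (edom h)) : 0 ≤ bregmanReal h x y := by
  unfold bregmanReal
  linarith [toReal_add_inner_grad_le hL hy hx]

lemma bregman_nonneg (hL : IsLegendre h) (x y : Euc N) : 0 ≤ bregman h x y := by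
  by_cases hx : x ∈ edom h
  · by_cases hy : y ∈ interior (edom h)
    · rw [bregman_eq_coe hL hx hy]
      exact_mod_cast bregmanReal_nonneg hL hx hy
    · simp [bregman, hy]
  · simp [bregman_eq_top hx]

lemma coe_mul_bregman_ne_bot (hL : IsLegendre h) {c : ℝ} (hc : 0 < c) (x y : Euc N) :
    (c : EReal) * bregman h x y ≠ ⊥ :=
  (EReal.bot_lt_zero.trans_le
    (mul_nonneg (EReal.coe_nonneg.2 hc.le) (bregman_nonneg hL x y))).ne'

lemma edom_coe_mul_bregman (hL : IsLegendre h) {c : ℝ} (hc : 0 < c) {y : Euc N}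
    (hy : y ∈ interior (edom h)) : edom (fun z => (c : EReal) * bregman h z y) = edom h := by
  ext z
  by_cases hz : z ∈ edom h
  · exact iff_of_true (mem_edom_of_eq_coe (r := c * bregmanReal h z y)
      (by rw [bregman_eq_coe hL hz hy, EReal.coe_mul])) hz
  · exact iff_of_false (by simp [edom, bregman_eq_top hz, EReal.coe_mul_top_of_pos hc]) hz

lemma lowerSemicontinuous_coe_mul_bregman (hL : IsLegendre h) {c : ℝ} (hc : 0 < c) {y : Euc N}
    (hy : y ∈ interior (edom h)) :
    LowerSemicontinuous (fun z => (c : EReal) * bregman h z y) := by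
  have hbregman : LowerSemicontinuous fun z => bregman h z y := by
    simp only [bregman, if_pos hy, sub_eq_add_neg, ← EReal.coe_neg]
    exact lowerSemicontinuous_add_coe hL.lsc (by fun_prop)
  have hc0 : (c : EReal) ≠ 0 := EReal.coe_ne_zero.2 hc.ne'
  have hmul : Continuous fun a : EReal => (c : EReal) * a := continuous_iff_continuousAt.2
    fun a => (EReal.continuousAt_mul (p := ((c : EReal), a)) (Or.inl hc0) (Or.inl hc0)
      (Or.inl (EReal.coe_ne_bot _)) (Or.inl (EReal.coe_ne_top _))).comp
        (f := fun a => ((c : EReal), a)) (by fun_prop)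
  exact hmul.comp_lowerSemicontinuous hbregman fun a b hab =>
    mul_le_mul_of_nonneg_left hab (EReal.coe_nonneg.2 hc.le)

lemma convexOn_bregmanReal (hL : IsLegendre h) (y : Euc N) :
    ConvexOn ℝ (edom h) fun z => bregmanReal h z y := by
  have hlin := (innerSL ℝ (-grad h y)).toLinearMap.convexOn hL.convexOn.1
  refine ((hL.convexOn.add hlin).add_const (inner ℝ (grad h y) y - (h y).toReal)).congr
    fun z _ => ?_
  simp only [bregmanReal, Pi.add_apply, ContinuousLinearMap.coe_coe, innerSL_apply_apply,
    inner_neg_left, inner_sub_right]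
  ring

lemma convexOn_coe_mul_bregman (hL : IsLegendre h) {c : ℝ} (hc : 0 < c) {y : Euc N}
    (hy : y ∈ interior (edom h)) :
    ConvexOn ℝ (edom fun z => (c : EReal) * bregman h z y)
      (fun z => ((c : EReal) * bregman h z y).toReal) := by
  rw [edom_coe_mul_bregman hL hc hy]
  refine ((convexOn_bregmanReal hL y).smul hc.le).congr fun z hz => ?_
  simp [bregman_eq_coe hL hz hy, EReal.toReal_mul]

lemma hasGradientAt_bregmanReal_left (hL : IsLegendre h) (y : Euc N) {x : Euc N}
    (hx : x ∈ interior (edom h)) :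
    HasGradientAt (fun z => bregmanReal h z y) (grad h x - grad h y) x := by
  have hsum := (hasGradientAt_add (hasGradientAt_grad hL hx)
    (hasGradientAt_inner_sub (-grad h y) y x)).hasFDerivAt.sub_const (h y).toReal
  rw [hasGradientAt_iff_hasFDerivAt, sub_eq_add_neg (grad h x)]
  refine hsum.congr_of_eventuallyEq (Eventually.of_forall fun z => ?_)
  simp only [bregmanReal, inner_neg_left]
  ring

lemma contDiffOn_grad (hC : ContDiffOn ℝ 2 (fun x => (h x).toReal) (interior (edom h))) :
    ContDiffOn ℝ 1 (grad h) (interior (edom h)) :=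
  (InnerProductSpace.toDual ℝ (Euc N)).symm.toContinuousLinearEquiv.contDiff.comp_contDiffOn
    (hC.fderiv_of_isOpen (m := 1) isOpen_interior (by norm_num))

/-- The gradient of `(x, y) ↦ D_h(x, y)`. The Hessian of `h` enters through its adjoint, so that
its symmetry need not be proved. -/
def bregmanGrad (h : Euc N → EReal) (z : Euc2 N) : Euc2 N :=
  WithLp.toLp 2 (grad h z.fst - grad h z.snd,
    -((fderiv ℝ (grad h) z.snd).adjoint (z.fst - z.snd)))

lemma hasGradientAt_bregmanReal (hL : IsLegendre h)
    (hC : ContDiffOn ℝ 2 (fun x => (h x).toReal) (interior (edom h))) {z : Euc2 N}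
    (hx : z.fst ∈ interior (edom h)) (hy : z.snd ∈ interior (edom h)) :
    HasGradientAt (fun z : Euc2 N => bregmanReal h z.fst z.snd) (bregmanGrad h z) z := by
  have hfst : HasFDerivAt (fun z : Euc2 N => z.fst) (WithLp.fstL 2 ℝ (Euc N) (Euc N)) z :=
    (WithLp.fstL 2 ℝ (Euc N) (Euc N)).hasFDerivAt
  have hsnd : HasFDerivAt (fun z : Euc2 N => z.snd) (WithLp.sndL 2 ℝ (Euc N) (Euc N)) z :=
    (WithLp.sndL 2 ℝ (Euc N) (Euc N)).hasFDerivAt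
  have hgrad : HasFDerivAt (grad h) (fderiv ℝ (grad h) z.snd) z.snd :=
    (((contDiffOn_grad hC).differentiableOn one_ne_zero _ hy).differentiableAt
      (isOpen_interior.mem_nhds hy)).hasFDerivAt
  rw [hasGradientAt_iff_hasFDerivAt]
  refine ((((hasGradientAt_grad hL hx).hasFDerivAt.comp z hfst).sub
    ((hasGradientAt_grad hL hy).hasFDerivAt.comp z hsnd)).sub
      ((hgrad.comp z hsnd).inner ℝ (hfst.sub hsnd))).congr_fderiv ?_
  ext d
  change inner ℝ (grad h z.fst) d.fst - inner ℝ (grad h z.snd) d.snd -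
    (inner ℝ (grad h z.snd) (d.fst - d.snd) +
      inner ℝ (fderiv ℝ (grad h) z.snd d.snd) (z.fst - z.snd)) =
    inner ℝ (grad h z.fst - grad h z.snd) d.fst +
      inner ℝ (-((fderiv ℝ (grad h) z.snd).adjoint (z.fst - z.snd))) d.snd
  rw [inner_neg_left, ContinuousLinearMap.adjoint_inner_left, real_inner_comm (z.fst - z.snd),
    inner_sub_left (grad h z.fst), inner_sub_right]
  ring

lemma continuousAt_bregmanGrad
    (hC : ContDiffOn ℝ 2 (fun x => (h x).toReal) (interior (edom h))) {z : Euc2 N}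
    (hx : z.fst ∈ interior (edom h)) (hy : z.snd ∈ interior (edom h)) :
    ContinuousAt (bregmanGrad h) z := by
  have hfst : ContinuousAt (fun z : Euc2 N => z.fst) z := by fun_prop
  have hsnd : ContinuousAt (fun z : Euc2 N => z.snd) z := by fun_prop
  have hgrad : ∀ u ∈ interior (edom h), ContinuousAt (grad h) u := fun u hu =>
    (contDiffOn_grad hC).continuousOn.continuousAt (isOpen_interior.mem_nhds hu)
  have hhess : ContinuousAt (fderiv ℝ (grad h)) z.snd :=
    ((contDiffOn_grad hC).continuousOn_fderiv_of_isOpen isOpen_interior le_rfl).continuousAt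
      (isOpen_interior.mem_nhds hy)
  have hadjoint : ContinuousAt (fun z : Euc2 N => (fderiv ℝ (grad h) z.snd).adjoint) z :=
    ContinuousLinearMap.adjoint.continuous.continuousAt.comp (hhess.comp hsnd)
  exact (WithLp.prod_continuous_toLp 2 (Euc N) (Euc N)).continuousAt.comp
    ((((hgrad _ hx).comp hfst).sub ((hgrad _ hy).comp hsnd)).prodMk
      (hadjoint.clm_apply (hfst.sub hsnd)).neg)

end Bregman

section Step

variable {f h : Euc N → EReal} {m : Euc N → Euc N → EReal} {Lu Ll : ℝ}

lemma mem_domConvexSubdiff_of_mem_limSubdiff_coe_mul_bregman (hL : IsLegendre h) {c : ℝ}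
    (hc : 0 < c) {x y p : Euc N} (hx : x ∈ edom h) (hy : y ∈ interior (edom h))
    (hp : p ∈ limSubdiff (fun z => (c : EReal) * bregman h z y) x) :
    x ∈ domConvexSubdiff h := by
  refine ⟨hx, c⁻¹ • p + grad h y, fun z => ?_⟩
  by_cases hz : z ∈ edom h
  · have hle := add_inner_le_of_mem_limSubdiff (fun z => coe_mul_bregman_ne_bot hL hc z y)
      (convexOn_coe_mul_bregman hL hc hy) hp z
    rw [bregman_eq_coe hL hx hy, bregman_eq_coe hL hz hy] at hle
    norm_cast at hle
    have hdiv : bregmanReal h x y + c⁻¹ * inner ℝ p (z - x) ≤ bregmanReal h z y := by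
      rw [← mul_le_mul_iff_right₀ hc, mul_add, mul_inv_cancel_left₀ hc.ne']
      exact hle
    rw [← coe_toReal_of_mem_edom hL hx, ← coe_toReal_of_mem_edom hL hz]
    norm_cast
    rw [inner_add_left, inner_smul_left, conj_trivial]
    simp only [bregmanReal, inner_sub_right] at hdiv ⊢
    linarith
  · have htop : h z = ⊤ := by simpa [edom] using hz
    exact htop ▸ le_top

/-- The qualification condition makes the sum rule applicable, so the Bregman distance has a
subgradient at the minimizer; a Legendre function has none on the boundary of its domain. -/
lemma mem_of_isMinOn_step (hm : ModelAssumption f h m Lu Ll) {x y : Euc N} {τ : ℝ} (hτ : 0 < τ)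
    (hy : y ∈ edom f ∩ interior (edom h))
    (hmin : IsMinOn (fun z => m z y + ((1 / τ : ℝ) : EReal) * bregman h z y) univ x) :
    x ∈ edom f ∩ interior (edom h) := by
  have hL := hm.legendre
  have hc : 0 < 1 / τ := one_div_pos.2 hτ
  set k : Euc N → EReal := fun z => ((1 / τ : ℝ) : EReal) * bregman h z y
  have hkbot (z : Euc N) : k z ≠ ⊥ := coe_mul_bregman_ne_bot hL hc z y
  have hkconv := convexOn_coe_mul_bregman hL hc hy.2
  have hkdom : edom k = edom h := edom_coe_mul_bregman hL hc hy.2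
  have hfinite : m x y ≠ ⊤ ∧ k x ≠ ⊤ := by
    have hky : k y < ⊤ := hkdom.ge (interior_subset hy.2)
    rw [← EReal.add_ne_top_iff_ne_top₂ (hm.model_ne_bot x y) (hkbot x)]
    exact ((hmin (mem_univ y)).trans_lt
      (EReal.add_lt_top (hm.model_lt_top hy.1 hy.1).ne hky.ne)).ne
  have hxf : x ∈ edom f := hm.joint_dom_subset x y hfinite.1.lt_top
  have hxh : x ∈ edom h := hkdom.le hfinite.2.lt_top
  have hpair : Continuous fun z => (WithLp.toLp 2 (z, y) : Euc2 N) := by fun_prop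
  have hlsc : LowerSemicontinuous fun z => m z y := hm.joint_lsc.comp hpair
  have hqual : ∀ v ∈ horizonSubdiff (fun z => m z y) x, -v ∈ horizonSubdiff k x → v = 0 :=
    fun v hv hkv => (hm.qualification y hy x ⟨hxf, hxh⟩).le
      ⟨hv, hkdom ▸ horizonSubdiff_subset_normalCone hkbot hkconv x hkv⟩
  obtain ⟨p, hp, -⟩ := exists_mem_limSubdiff_neg_mem_of_isMinOn_add hlsc
    (lowerSemicontinuous_coe_mul_bregman hL hc hy.2) (fun z => hm.model_ne_bot z y) hkbot
    hfinite.1.lt_top hfinite.2.lt_top hmin hqual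
  exact ⟨hxf, domConvexSubdiff_subset_interior hL
    (mem_domConvexSubdiff_of_mem_limSubdiff_coe_mul_bregman hL hc hxh hy.2 hp)⟩

lemma neg_smul_grad_sub_mem_frechetSubdiff_of_isMinOn_step (hm : ModelAssumption f h m Lu Ll)
    {x y : Euc N} {τ : ℝ} (hy : y ∈ edom f ∩ interior (edom h))
    (hx : x ∈ edom f ∩ interior (edom h))
    (hmin : IsMinOn (fun z => m z y + ((1 / τ : ℝ) : EReal) * bregman h z y) univ x) :
    -((1 / τ) • (grad h x - grad h y)) ∈ frechetSubdiff (fun z => m z y) x := by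
  have hL := hm.legendre
  refine neg_mem_frechetSubdiff_of_isLocalMin_add (hm.model_lt_top hx.1 hy.1)
    (hasGradientAt_const_mul (1 / τ) (hasGradientAt_bregmanReal_left hL y hx.2)) ?_
  filter_upwards [isOpen_interior.mem_nhds hx.2] with z hz
  rw [EReal.coe_mul, EReal.coe_mul, ← bregman_eq_coe hL (interior_subset hx.2) hy.2,
    ← bregman_eq_coe hL (interior_subset hz) hy.2]
  exact hmin (mem_univ z)

lemma model_self (hf : IsProper f) (hm : ModelAssumption f h m Lu Ll) {y : Euc N}
    (hy : y ∈ edom f ∩ interior (edom h)) : m y y = f y := by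
  obtain ⟨-, ω, hω, hle⟩ := hm.model y hy
  have hself := hle y hy.1
  rw [sub_self, norm_zero, hω.map_zero] at hself
  exact (EReal.toReal_eq_toReal (hm.model_lt_top hy.1 hy.1).ne (hm.model_ne_bot y y)
    (ne_of_lt hy.1) (hf.1 y)).1 (sub_eq_zero.1 (abs_nonpos_iff.1 hself)).symm

/-- The Lyapunov function as a real-valued function; it agrees with `lyapunov` on
`(dom f ∩ dom h) × (dom f ∩ int dom h)` only. -/
def lyapunovReal (h : Euc N → EReal) (m : Euc N → Euc N → EReal) (Lu : ℝ) (x y : Euc N) : ℝ :=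
  (m x y).toReal + Lu * bregmanReal h x y

lemma lyapunov_eq_add (hm : ModelAssumption f h m Lu Ll) {z : Euc2 N}
    (hx : z.fst ∈ edom h) (hy : z.snd ∈ interior (edom h)) :
    lyapunov h m Lu z = joint m z + ((Lu * bregmanReal h z.fst z.snd : ℝ) : EReal) := by
  rw [lyapunov, bregman_eq_coe hm.legendre hx hy, EReal.coe_mul, joint]

lemma lyapunov_eq_coe (hm : ModelAssumption f h m Lu Ll) {x y : Euc N}
    (hx : x ∈ edom f ∩ edom h) (hy : y ∈ edom f ∩ interior (edom h)) :
    lyapunov h m Lu (WithLp.toLp 2 (x, y)) = (lyapunovReal h m Lu x y : ℝ) := by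
  obtain ⟨r, hr⟩ := hm.exists_model_eq_coe hx.1 hy.1
  rw [lyapunov_eq_add (z := WithLp.toLp 2 (x, y)) hm hx.2 hy.2, lyapunovReal, hr,
    EReal.toReal_coe, EReal.coe_add]
  exact congrArg (· + _) hr

/-- Minimality of `x` against the competitor `y` gives `m x y + D_h(x, y) / τ ≤ f y`, and `f y` is
at most `m y w + Lu D_h(y, w)` for every earlier centre `w`. -/
lemma lyapunovReal_add_le_of_isMinOn_step (hf : IsProper f) (hm : ModelAssumption f h m Lu Ll)
    {w x y : Euc N} {τ τhi : ℝ} (hτ : 0 < τ) (hτhi : τ ≤ τhi)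
    (hw : w ∈ edom f ∩ interior (edom h)) (hy : y ∈ edom f ∩ interior (edom h))
    (hx : x ∈ edom f ∩ interior (edom h))
    (hmin : IsMinOn (fun z => m z y + ((1 / τ : ℝ) : EReal) * bregman h z y) univ x) :
    lyapunovReal h m Lu x y + (1 / τhi - Lu) * bregmanReal h x y ≤ lyapunovReal h m Lu y w := by
  have hL := hm.legendre
  have hxd := interior_subset hx.2
  have hyd := interior_subset hy.2
  obtain ⟨r, hr⟩ := hm.exists_model_eq_coe hx.1 hy.1
  obtain ⟨s, hs⟩ := exists_real_of_mem_edom hf.1 hy.1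
  have hcompare : r + 1 / τ * bregmanReal h x y ≤ s := by
    have hle := hmin (mem_univ y)
    simp only [mem_ofPred_eq] at hle
    rw [bregman_eq_coe hL hxd hy.2, bregman_eq_coe hL hyd hy.2, bregmanReal_self,
      model_self hf hm hy, hr, hs, EReal.coe_zero, mul_zero, add_zero] at hle
    exact_mod_cast hle
  have hupper : s ≤ lyapunovReal h m Lu y w := by
    have hle := (hm.map w hw y ⟨hy.1, hyd⟩).2
    rw [bregman_eq_coe hL hyd hw.2, EReal.toReal_coe, hs, EReal.toReal_coe] at hle
    rw [lyapunovReal]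
    linarith
  have hτle : 1 / τhi * bregmanReal h x y ≤ 1 / τ * bregmanReal h x y :=
    mul_le_mul_of_nonneg_right (one_div_le_one_div_of_le hτ hτhi) (bregmanReal_nonneg hL hxd hy.2)
  simp only [lyapunovReal, hr, EReal.toReal_coe] at hupper ⊢
  linarith

lemma exists_ball_lipschitzOnWith_grad
    (hC : ContDiffOn ℝ 2 (fun x => (h x).toReal) (interior (edom h))) {xbar : Euc N}
    (hxbar : xbar ∈ interior (edom h)) :
    ∃ (ρ : ℝ) (K : NNReal), 0 < ρ ∧ Metric.ball xbar ρ ⊆ interior (edom h) ∧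
      LipschitzOnWith K (grad h) (Metric.ball xbar ρ) := by
  have hinterior := isOpen_interior.mem_nhds hxbar
  obtain ⟨K, t, ht, hK⟩ := ((contDiffOn_grad hC).contDiffAt hinterior).exists_lipschitzOnWith
  obtain ⟨ρ, hρ, hball⟩ := Metric.nhds_basis_ball.mem_iff.1 (inter_mem ht hinterior)
  exact ⟨ρ, K, hρ, hball.trans inter_subset_right, hK.mono (hball.trans inter_subset_left)⟩

lemma toLp_add_smul_bregmanGrad_mem_limSubdiff_lyapunov (hm : ModelAssumption f h m Lu Ll)
    {x y v w : Euc N} (hx : x ∈ interior (edom h)) (hy : y ∈ interior (edom h))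
    (hvw : WithLp.toLp 2 (v, w) ∈ limSubdiff (joint m) (WithLp.toLp 2 (x, y))) :
    WithLp.toLp 2 (v, w) + Lu • bregmanGrad h (WithLp.toLp 2 (x, y)) ∈
      limSubdiff (lyapunov h m Lu) (WithLp.toLp 2 (x, y)) := by
  have hfst : ContinuousAt (fun z : Euc2 N => z.fst) (WithLp.toLp 2 (x, y)) := by fun_prop
  have hsnd : ContinuousAt (fun z : Euc2 N => z.snd) (WithLp.toLp 2 (x, y)) := by fun_prop
  have hnear : ∀ᶠ z : Euc2 N in 𝓝 (WithLp.toLp 2 (x, y)),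
      z.fst ∈ interior (edom h) ∧ z.snd ∈ interior (edom h) :=
    (hfst.eventually (isOpen_interior.mem_nhds hx)).and
      (hsnd.eventually (isOpen_interior.mem_nhds hy))
  exact add_mem_limSubdiff (G := fun z => Lu • bregmanGrad h z) hvw
    (hnear.mono fun z hz =>
      hasGradientAt_const_mul Lu (hasGradientAt_bregmanReal hm.legendre hm.contDiffOn hz.1 hz.2))
    ((continuousAt_bregmanGrad (z := WithLp.toLp 2 (x, y)) hm.contDiffOn hx hy).const_smul Lu)
    (hnear.mono fun z hz => lyapunov_eq_add hm (interior_subset hz.1) hz.2)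

lemma norm_toLp_add_smul_bregmanGrad_le (hLu : 0 < Lu) {ρ : ℝ} {K : NNReal} {xbar : Euc N}
    (hK : LipschitzOnWith K (grad h) (Metric.ball xbar ρ)) {x y : Euc N}
    (hx : x ∈ Metric.ball xbar ρ) (hy : y ∈ Metric.ball xbar ρ) {τ : ℝ} (hτ : 0 < τ)
    (w : Euc N) :
    ‖WithLp.toLp 2 (-((1 / τ) • (grad h x - grad h y)), w) +
      Lu • bregmanGrad h (WithLp.toLp 2 (x, y))‖ ≤
      (1 / τ + 2 * Lu) * K * ‖x - y‖ + ‖w‖ := by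
  have hgrad : ‖grad h x - grad h y‖ ≤ K * ‖x - y‖ := hK.norm_sub_le hx hy
  have hhess : ‖fderiv ℝ (grad h) y‖ ≤ K :=
    norm_fderiv_le_of_lipschitzOn ℝ (Metric.isOpen_ball.mem_nhds hy) hK
  have hfst : ‖-((1 / τ) • (grad h x - grad h y))‖ ≤ 1 / τ * (K * ‖x - y‖) := by
    rw [norm_neg, norm_smul, Real.norm_of_nonneg (by positivity)]
    gcongr
  have hsnd : ‖-((fderiv ℝ (grad h) y).adjoint (x - y))‖ ≤ K * ‖x - y‖ := by
    rw [norm_neg]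
    refine (ContinuousLinearMap.le_opNorm _ _).trans ?_
    rw [LinearIsometryEquiv.norm_map]
    gcongr
  calc ‖WithLp.toLp 2 (-((1 / τ) • (grad h x - grad h y)), w) +
        Lu • bregmanGrad h (WithLp.toLp 2 (x, y))‖
      ≤ ‖WithLp.toLp 2 (-((1 / τ) • (grad h x - grad h y)), w)‖ +
        Lu * ‖bregmanGrad h (WithLp.toLp 2 (x, y))‖ := by
        refine (norm_add_le _ _).trans_eq ?_
        rw [norm_smul, Real.norm_of_nonneg hLu.le]
    _ ≤ (1 / τ * (K * ‖x - y‖) + ‖w‖) + Lu * (K * ‖x - y‖ + K * ‖x - y‖) := by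
        gcongr
        · exact (norm_toLp_le_add _ _).trans (add_le_add_left hfst _)
        · exact (norm_toLp_le_add _ _).trans (add_le_add hgrad hsnd)
    _ = (1 / τ + 2 * Lu) * K * ‖x - y‖ + ‖w‖ := by ring

lemma exists_subdiffNorm_lyapunov_le (hm : ModelAssumption f h m Lu Ll)
    (hrel : RelativeErrorAssumption f m) {xbar : Euc N} (hxbar : xbar ∈ interior (edom h))
    {τlo : ℝ} (hτlo : 0 < τlo) :
    ∃ ρ b : ℝ, 0 < ρ ∧ 0 < b ∧ ∀ x ∈ edom f ∩ Metric.ball xbar ρ,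
      ∀ y ∈ edom f ∩ Metric.ball xbar ρ, ∀ τ : ℝ, τlo ≤ τ →
      IsMinOn (fun z => m z y + ((1 / τ : ℝ) : EReal) * bregman h z y) univ x →
      subdiffNorm (lyapunov h m Lu) (WithLp.toLp 2 (x, y)) ≤ ENNReal.ofReal (b * ‖x - y‖) := by
  have hLu := hm.Lu_pos
  obtain ⟨ρ, K, hρ, hinterior, hK⟩ := exists_ball_lipschitzOnWith_grad hm.contDiffOn hxbar
  obtain ⟨c, hc, hrelB⟩ := hrel (edom f ∩ Metric.ball xbar ρ) inter_subset_left
    (Metric.isBounded_ball.subset inter_subset_right)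
  refine ⟨ρ, (1 / τlo + 2 * Lu) * K + c, hρ, by positivity, fun x hx y hy τ hτ hmin => ?_⟩
  have hv := frechetSubdiff_subset_limSubdiff _ _
    (neg_smul_grad_sub_mem_frechetSubdiff_of_isMinOn_step hm ⟨hy.1, hinterior hy.2⟩
      ⟨hx.1, hinterior hx.2⟩ hmin)
  refine ENNReal.le_of_forall_pos_le_add fun ε hε _ => ?_
  obtain ⟨w, hw, hwle⟩ := exists_toLp_mem_limSubdiff_joint_norm_le hm Metric.isOpen_ball hc hrelB
    hx hy hv (NNReal.coe_pos.2 hε)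
  rw [← ENNReal.ofReal_coe_nnreal, ← ENNReal.ofReal_add (by positivity) ε.coe_nonneg]
  refine (iInf₂_le _ (toLp_add_smul_bregmanGrad_mem_limSubdiff_lyapunov hm (hinterior hx.2)
    (hinterior hy.2) hw)).trans ?_
  rw [← ofReal_norm]
  refine ENNReal.ofReal_le_ofReal ?_
  calc _ ≤ (1 / τ + 2 * Lu) * K * ‖x - y‖ + ‖w‖ :=
        norm_toLp_add_smul_bregmanGrad_le hLu hK hx.2 hy.2 (hτlo.trans_le hτ) w
    _ ≤ (1 / τlo + 2 * Lu) * K * ‖x - y‖ + (c * ‖x - y‖ + ε) := by gcongr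
    _ = ((1 / τlo + 2 * Lu) * K + c) * ‖x - y‖ + ε := by ring

end Step

section Rates

/-- The weighted arithmetic-geometric mean inequality, in the form of the concavity of
`s ↦ s ^ (1 - θ)`. -/
lemma one_sub_mul_sub_le_rpow_mul_rpow_sub {s t θ : ℝ} (hs : 0 < s) (ht : 0 ≤ t) (hθ0 : 0 ≤ θ)
    (hθ1 : θ ≤ 1) : (1 - θ) * (s - t) ≤ s ^ θ * (s ^ (1 - θ) - t ^ (1 - θ)) := by
  have hmean := Real.geom_mean_le_arith_mean2_weighted hθ0 (sub_nonneg.2 hθ1) hs.le ht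
    (add_sub_cancel θ 1)
  rw [mul_sub (s ^ θ), ← Real.rpow_add hs, add_sub_cancel, Real.rpow_one]
  linarith

lemma inv_rpow_add_le_inv_rpow {s t p M : ℝ} (hs : 0 < s) (ht : 0 < t) (ht1 : t ≤ 1)
    (hp0 : 0 ≤ p) (hp1 : p ≤ 1) (hM : 0 < M) (hrec : t ^ (1 + p) ≤ M * (s - t)) :
    (s ^ p)⁻¹ + p / (M + 1) ≤ (t ^ p)⁻¹ := by
  have hS : 0 < s ^ p := Real.rpow_pos_of_pos hs p
  have hT : 0 < t ^ p := Real.rpow_pos_of_pos ht p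
  have hT1 : t ^ p ≤ 1 := Real.rpow_le_one ht.le ht1 hp0
  rw [Real.rpow_add ht, Real.rpow_one] at hrec
  have hts : 0 < s - t := pos_of_mul_pos_right ((mul_pos ht hT).trans_le hrec) hM.le
  have hgap : s * t ^ p ≤ (M + 1) * (s - t) := by
    linarith [mul_le_mul_of_nonneg_left hT1 hts.le]
  have hconcave : p * (s - t) * s ^ p ≤ s * (s ^ p - t ^ p) := by
    have hle := one_sub_mul_sub_le_rpow_mul_rpow_sub hs ht.le (sub_nonneg.2 hp1)
      (sub_le_self 1 hp0)
    rw [sub_sub_cancel] at hle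
    calc p * (s - t) * s ^ p ≤ s ^ (1 - p) * (s ^ p - t ^ p) * s ^ p := by gcongr
      _ = s ^ (1 - p) * s ^ p * (s ^ p - t ^ p) := by ring
      _ = s * (s ^ p - t ^ p) := by rw [← Real.rpow_add hs, sub_add_cancel, Real.rpow_one]
  have hdiff : p / (M + 1) * (s ^ p * t ^ p) ≤ s ^ p - t ^ p := by
    rw [← mul_le_mul_iff_right₀ hs]
    calc s * (p / (M + 1) * (s ^ p * t ^ p)) = p * s ^ p * (s * t ^ p) / (M + 1) := by ring
      _ ≤ p * s ^ p * ((M + 1) * (s - t)) / (M + 1) := by gcongr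
      _ = p * (s - t) * s ^ p := by field_simp
      _ ≤ s * (s ^ p - t ^ p) := hconcave
  calc (s ^ p)⁻¹ + p / (M + 1)
      = (t ^ p + p / (M + 1) * (s ^ p * t ^ p)) / (s ^ p * t ^ p) := by field_simp
    _ ≤ s ^ p / (s ^ p * t ^ p) := by gcongr; linarith
    _ = (t ^ p)⁻¹ := by field_simp

lemma mul_le_inv_rpow_of_rpow_le_mul_sub {e : ℕ → ℝ} {p M : ℝ} (hp0 : 0 ≤ p) (hp1 : p ≤ 1)
    (hM : 0 < M) (hpos : ∀ n, 0 < e n) (hle : ∀ n, e n ≤ 1)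
    (hrec : ∀ n, e (n + 1) ^ (1 + p) ≤ M * (e n - e (n + 1))) (n : ℕ) :
    p / (M + 1) * n ≤ (e n ^ p)⁻¹ := by
  induction n with
  | zero => simpa using Real.rpow_nonneg (hpos 0).le p
  | succ n ih =>
    have hstep := inv_rpow_add_le_inv_rpow (hpos n) (hpos (n + 1)) (hle (n + 1)) hp0 hp1 hM (hrec n)
    push_cast
    linarith

lemma le_pow_mul_of_le_mul_sub {e : ℕ → ℝ} {M : ℝ} (hM : 0 ≤ M)
    (hrec : ∀ n, e (n + 1) ≤ M * (e n - e (n + 1))) (n : ℕ) : e n ≤ (M / (1 + M)) ^ n * e 0 := by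
  refine le_geom (by positivity) n fun k _ => ?_
  rw [div_mul_eq_mul_div, le_div_iff₀ (by positivity)]
  linarith [hrec k]

variable {V : Type*} [NormedAddCommGroup V]

lemma norm_sub_le_of_two_mul_norm_sub_le {X : ℕ → V} {xbar : V} {δ : ℕ → ℝ}
    (hX : Tendsto X atTop (𝓝 xbar)) (hδ : ∀ n, 0 ≤ δ n)
    (hstep : ∀ n, 2 * ‖X (n + 2) - X (n + 1)‖ ≤ ‖X (n + 1) - X n‖ + (δ n - δ (n + 1))) (n : ℕ) :
    ‖X (n + 1) - xbar‖ ≤ ‖X (n + 1) - X n‖ + δ n := by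
  have hpartial (j : ℕ) : ‖X (n + 1) - X (n + j + 1)‖ + ‖X (n + j + 1) - X (n + j)‖ + δ (n + j) ≤
      ‖X (n + 1) - X n‖ + δ n := by
    induction j with
    | zero => simp
    | succ j ih =>
      have htriangle :=
        norm_sub_le_norm_sub_add_norm_sub (X (n + 1)) (X (n + j + 1)) (X (n + j + 2))
      rw [norm_sub_rev (X (n + j + 1)) (X (n + j + 2))] at htriangle
      have hnext := hstep (n + j)
      rw [← add_assoc n j 1]
      linarith
  have htail : Tendsto (fun j => X (n + j + 1)) atTop (𝓝 xbar) := by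
    simp only [add_comm n]
    exact (tendsto_add_atTop_iff_nat n).2 ((tendsto_add_atTop_iff_nat 1).2 hX)
  refine le_of_tendsto' (tendsto_const_nhds.sub htail).norm fun j => ?_
  linarith [hpartial j, hδ (n + j), norm_nonneg (X (n + j + 1) - X (n + j))]

/-- A sequence `X` converging to `xbar` along which an energy `e` decreases to `0` by at least the
squared steps and satisfies the Kurdyka–Łojasiewicz inequality with exponent `θ`. Bounding the
energy by `1` makes its powers decreasing in the exponent. -/
structure IsKLDescent (X : ℕ → V) (xbar : V) (e : ℕ → ℝ) (a C θ : ℝ) : Prop where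
  a_pos : 0 < a
  C_pos : 0 < C
  tendsto : Tendsto X atTop (𝓝 xbar)
  tendsto_energy : Tendsto e atTop (𝓝 0)
  energy_le_one : ∀ n, e n ≤ 1
  decrease : ∀ n, e (n + 1) + a * ‖X (n + 2) - X (n + 1)‖ ^ 2 ≤ e n
  kl : ∀ n, 0 < e n → e n ^ θ ≤ C * ‖X (n + 1) - X n‖

namespace IsKLDescent

variable {X : ℕ → V} {xbar : V} {e : ℕ → ℝ} {a C θ : ℝ}

lemma antitone_energy (hd : IsKLDescent X xbar e a C θ) : Antitone e :=
  antitone_nat_of_succ_le fun n =>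
    (le_add_of_nonneg_right (mul_nonneg hd.a_pos.le (sq_nonneg _))).trans (hd.decrease n)

lemma energy_nonneg (hd : IsKLDescent X xbar e a C θ) (n : ℕ) : 0 ≤ e n :=
  hd.antitone_energy.le_of_tendsto hd.tendsto_energy n

lemma eventually_eq_of_energy_nonpos (hd : IsKLDescent X xbar e a C θ) {n₀ : ℕ} (hn₀ : e n₀ ≤ 0) :
    ∀ᶠ n in atTop, X n = xbar := by
  have hstep : ∀ n, n₀ ≤ n → X (n + 2) = X (n + 1) := fun n hn => by
    have hsq : a * ‖X (n + 2) - X (n + 1)‖ ^ 2 ≤ 0 := by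
      linarith [hd.decrease n, hd.energy_nonneg (n + 1), hd.antitone_energy hn]
    have hsq0 := nonpos_of_mul_nonpos_right hsq hd.a_pos
    simpa [sub_eq_zero] using le_antisymm hsq0 (sq_nonneg _)
  have hconst : ∀ n, n₀ + 1 ≤ n → X n = X (n₀ + 1) := fun n hn => by
    induction n, hn using Nat.le_induction with
    | base => rfl
    | succ n hn ih =>
      obtain ⟨k, rfl⟩ := Nat.exists_eq_add_of_le' hn
      exact (hstep (k + n₀) (Nat.le_add_left n₀ k)).trans ih
  have hlimit : X (n₀ + 1) = xbar := tendsto_nhds_unique (tendsto_const_nhds.congr'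
    ((eventually_ge_atTop (n₀ + 1)).mono fun n hn => (hconst n hn).symm)) hd.tendsto
  exact (eventually_ge_atTop (n₀ + 1)).mono fun n hn => (hconst n hn).trans hlimit

/-- With exponent `0` the steps are bounded below as long as the energy is positive. -/
lemma eventually_eq_of_exponent_zero (hd : IsKLDescent X xbar e a C 0) :
    ∀ᶠ n in atTop, X n = xbar := by
  suffices ∃ n, e n ≤ 0 from this.elim fun _ => hd.eventually_eq_of_energy_nonpos
  by_contra! hpos
  have hstep : Tendsto (fun n => C * ‖X (n + 1) - X n‖) atTop (𝓝 0) := by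
    simpa using ((((tendsto_add_atTop_iff_nat 1).2 hd.tendsto).sub hd.tendsto).norm).const_mul C
  exact zero_lt_one.not_ge (ge_of_tendsto' hstep fun n => by simpa using hd.kl n (hpos n))

lemma energy_succ_rpow_le (hd : IsKLDescent X xbar e a C θ) (hpos : ∀ n, 0 < e n) (n : ℕ) :
    e (n + 1) ^ (2 * θ) ≤ C ^ 2 / a * (e n - e (n + 1)) := by
  have ha := hd.a_pos
  have hθ := Real.rpow_nonneg (hpos (n + 1)).le θ
  calc e (n + 1) ^ (2 * θ) = (e (n + 1) ^ θ) ^ 2 := by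
        rw [mul_comm, ← Nat.cast_two, Real.rpow_mul_natCast (hpos (n + 1)).le]
    _ ≤ (C * ‖X (n + 2) - X (n + 1)‖) ^ 2 := by
        gcongr
        exact hd.kl (n + 1) (hpos (n + 1))
    _ = C ^ 2 / a * (a * ‖X (n + 2) - X (n + 1)‖ ^ 2) := by field_simp
    _ ≤ C ^ 2 / a * (e n - e (n + 1)) := by
        gcongr
        linarith [hd.decrease n]

lemma norm_step_le_sqrt (hd : IsKLDescent X xbar e a C θ) (n : ℕ) :
    ‖X (n + 2) - X (n + 1)‖ ≤ √(e n / a) := by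
  refine Real.le_sqrt_of_sq_le ?_
  rw [le_div_iff₀ hd.a_pos]
  linarith [hd.decrease n, hd.energy_nonneg (n + 1)]

lemma exists_isBigO_pow_of_energy_pos (hd : IsKLDescent X xbar e a C θ) (hθ : θ ≤ 1 / 2)
    (hpos : ∀ n, 0 < e n) : ∃ ρ : ℝ, 0 < ρ ∧ ρ < 1 ∧
      (fun n => X (n + 1) - xbar) =O[atTop] fun n => ρ ^ n := by
  have ha := hd.a_pos
  have hC := hd.C_pos
  set q := C ^ 2 / a / (1 + C ^ 2 / a)
  have hq0 : 0 < q := by positivity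
  have hq1 : q < 1 := (div_lt_one (by positivity)).2 (lt_one_add _)
  have hgeometric : ∀ n, e n ≤ q ^ n * e 0 := le_pow_mul_of_le_mul_sub (by positivity) fun n =>
    calc e (n + 1) = e (n + 1) ^ (1 : ℝ) := (Real.rpow_one _).symm
      _ ≤ e (n + 1) ^ (2 * θ) := Real.rpow_le_rpow_of_exponent_ge (hpos _) (hd.energy_le_one _)
          (by linarith)
      _ ≤ _ := hd.energy_succ_rpow_le hpos n
  have hdist (n : ℕ) : dist (X (n + 1)) (X (n + 2)) ≤ √(e 0 / a) * √q ^ n := by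
    rw [dist_comm, dist_eq_norm]
    refine (hd.norm_step_le_sqrt n).trans (Real.sqrt_le_iff.2 ⟨by positivity, ?_⟩)
    rw [mul_pow, pow_right_comm, Real.sq_sqrt (div_pos (hpos 0) ha).le, Real.sq_sqrt hq0.le,
      div_mul_eq_mul_div, mul_comm]
    gcongr
    exact hgeometric n
  have hρ1 : √q < 1 := (Real.sqrt_lt' one_pos).2 (by simpa using hq1)
  refine ⟨√q, Real.sqrt_pos.2 hq0, hρ1, Asymptotics.IsBigO.of_bound (√(e 0 / a) / (1 - √q))
    (Eventually.of_forall fun n => ?_)⟩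
  have hsum := dist_le_of_le_geometric_of_tendsto (√q) _ hρ1 hdist
    ((tendsto_add_atTop_iff_nat 1).2 hd.tendsto) n
  rw [Real.norm_of_nonneg (by positivity), ← dist_eq_norm, div_mul_eq_mul_div]
  exact hsum

/-- Concavity of the desingularizing function turns the Kurdyka–Łojasiewicz inequality and the
decrease into `d' ^ 2 ≤ d * (δ n - δ (n + 1))` for successive step lengths `d`, `d'`; conclude by
the arithmetic-geometric mean inequality. -/
lemma two_mul_norm_step_le (hd : IsKLDescent X xbar e a C θ) (hθ0 : 0 ≤ θ) (hθ1 : θ < 1)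
    (hpos : ∀ n, 0 < e n) (n : ℕ) :
    2 * ‖X (n + 2) - X (n + 1)‖ ≤ ‖X (n + 1) - X n‖ +
      (C / ((1 - θ) * a) * e n ^ (1 - θ) - C / ((1 - θ) * a) * e (n + 1) ^ (1 - θ)) := by
  have ha := hd.a_pos
  have hC := hd.C_pos
  have hq : 0 < 1 - θ := sub_pos.2 hθ1
  set Δ := e n ^ (1 - θ) - e (n + 1) ^ (1 - θ)
  have hΔ : 0 ≤ Δ := sub_nonneg.2
    (Real.rpow_le_rpow (hpos _).le (hd.antitone_energy n.le_succ) hq.le)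
  have hsq : ‖X (n + 2) - X (n + 1)‖ ^ 2 ≤ ‖X (n + 1) - X n‖ * (C / ((1 - θ) * a) * Δ) := by
    rw [← mul_le_mul_iff_right₀ (mul_pos hq ha)]
    calc (1 - θ) * a * ‖X (n + 2) - X (n + 1)‖ ^ 2
        = (1 - θ) * (a * ‖X (n + 2) - X (n + 1)‖ ^ 2) := mul_assoc _ _ _
      _ ≤ (1 - θ) * (e n - e (n + 1)) := by
        gcongr
        linarith [hd.decrease n]
      _ ≤ e n ^ θ * Δ :=
        one_sub_mul_sub_le_rpow_mul_rpow_sub (hpos n) (hpos (n + 1)).le hθ0 hθ1.le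
      _ ≤ C * ‖X (n + 1) - X n‖ * Δ := by
        gcongr
        exact hd.kl n (hpos n)
      _ = (1 - θ) * a * (‖X (n + 1) - X n‖ * (C / ((1 - θ) * a) * Δ)) := by field_simp
  rw [← mul_sub]
  refine (abs_le_of_sq_le_sq' ?_ (by positivity)).2
  nlinarith [sq_nonneg (‖X (n + 1) - X n‖ - C / ((1 - θ) * a) * Δ)]

lemma norm_sub_le_energy_rpow (hd : IsKLDescent X xbar e a C θ) (hθ0 : 1 / 2 ≤ θ) (hθ1 : θ < 1)
    (hpos : ∀ n, 0 < e n) (n : ℕ) :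
    ‖X (n + 2) - xbar‖ ≤ (1 / √a + C / ((1 - θ) * a)) * e n ^ (1 - θ) := by
  have ha := hd.a_pos
  have hC := hd.C_pos
  have : 0 < 1 - θ := sub_pos.2 hθ1
  have hstep : ‖X (n + 2) - X (n + 1)‖ ≤ 1 / √a * e n ^ (1 - θ) := by
    calc ‖X (n + 2) - X (n + 1)‖ ≤ √(e n / a) := hd.norm_step_le_sqrt n
      _ = 1 / √a * e n ^ (1 / 2 : ℝ) := by
        rw [Real.sqrt_div (hpos n).le, Real.sqrt_eq_rpow (e n), div_eq_mul_one_div, mul_comm]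
      _ ≤ 1 / √a * e n ^ (1 - θ) := mul_le_mul_of_nonneg_left
        (Real.rpow_le_rpow_of_exponent_ge (hpos n) (hd.energy_le_one n) (by linarith))
        (by positivity)
  have htail := norm_sub_le_of_two_mul_norm_sub_le hd.tendsto
    (fun k => mul_nonneg (by positivity) (Real.rpow_nonneg (hpos k).le (1 - θ)))
    (hd.two_mul_norm_step_le (by linarith) hθ1 hpos) (n + 1)
  have hmono : C / ((1 - θ) * a) * e (n + 1) ^ (1 - θ) ≤ C / ((1 - θ) * a) * e n ^ (1 - θ) := by
    have := (hpos (n + 1)).le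
    gcongr
    exact hd.antitone_energy n.le_succ
  calc ‖X (n + 2) - xbar‖ ≤ _ := htail
    _ ≤ 1 / √a * e n ^ (1 - θ) + C / ((1 - θ) * a) * e n ^ (1 - θ) := add_le_add hstep hmono
    _ = _ := (add_mul _ _ _).symm

lemma energy_rpow_isBigO (hd : IsKLDescent X xbar e a C θ) (hθ0 : 1 / 2 < θ) (hθ1 : θ < 1)
    (hpos : ∀ n, 0 < e n) :
    (fun n => e n ^ (1 - θ)) =O[atTop] fun n : ℕ => (n : ℝ) ^ (-((1 - θ) / (2 * θ - 1))) := by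
  have hp : 0 < 2 * θ - 1 := by linarith
  have : 0 < 1 - θ := sub_pos.2 hθ1
  have hM : 0 < C ^ 2 / a := div_pos (pow_pos hd.C_pos 2) hd.a_pos
  have hgrowth := mul_le_inv_rpow_of_rpow_le_mul_sub hp.le (by linarith) hM hpos hd.energy_le_one
    fun n => by
      rw [add_sub_cancel]
      exact hd.energy_succ_rpow_le hpos n
  set μ := (2 * θ - 1) / (C ^ 2 / a + 1)
  have hμ : 0 < μ := by positivity
  refine Asymptotics.IsBigO.of_bound (μ ^ (-((1 - θ) / (2 * θ - 1)))) ?_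
  filter_upwards [eventually_gt_atTop 0] with n hn
  have hn0 : (0 : ℝ) < n := Nat.cast_pos.2 hn
  have hE : 0 < e n ^ (2 * θ - 1) := Real.rpow_pos_of_pos (hpos n) _
  rw [Real.norm_of_nonneg (Real.rpow_nonneg (hpos n).le _),
    Real.norm_of_nonneg (Real.rpow_nonneg hn0.le _)]
  calc e n ^ (1 - θ) = (e n ^ (2 * θ - 1)) ^ ((1 - θ) / (2 * θ - 1)) := by
        rw [← Real.rpow_mul (hpos n).le, mul_div_cancel₀ _ hp.ne']
    _ ≤ ((μ * n)⁻¹) ^ ((1 - θ) / (2 * θ - 1)) := by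
        gcongr
        exact (le_inv_comm₀ hE (by positivity)).2 (hgrowth n)
    _ = μ ^ (-((1 - θ) / (2 * θ - 1))) * (n : ℝ) ^ (-((1 - θ) / (2 * θ - 1))) := by
        rw [Real.inv_rpow (by positivity), ← Real.rpow_neg (by positivity),
          Real.mul_rpow hμ.le hn0.le]

end IsKLDescent

lemma isBigO_of_shift {u : ℕ → V} {g : ℕ → ℝ} {k : ℕ} (hu : (fun n => u (n + k)) =O[atTop] g)
    (hg : g =O[atTop] fun n => g (n + k)) : u =O[atTop] g := by
  rw [← map_add_atTop_eq_nat k, Asymptotics.isBigO_map]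
  exact hu.trans hg

lemma isBigO_pow_of_shift {u : ℕ → V} {ρ : ℝ} (hρ : ρ ≠ 0) {k : ℕ}
    (hu : (fun n => u (n + k)) =O[atTop] fun n => ρ ^ n) : u =O[atTop] fun n => ρ ^ n := by
  refine isBigO_of_shift hu ?_
  simp only [pow_add, mul_comm _ (ρ ^ k)]
  exact Asymptotics.isBigO_self_const_mul (pow_ne_zero k hρ) _ _

lemma isBigO_rpow_neg_of_shift {u : ℕ → V} {r : ℝ} (hr : 0 ≤ r) {k : ℕ}
    (hu : (fun n => u (n + k)) =O[atTop] fun n : ℕ => (n : ℝ) ^ (-r)) :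
    u =O[atTop] fun n : ℕ => (n : ℝ) ^ (-r) := by
  refine isBigO_of_shift hu (Asymptotics.IsBigO.of_bound (2 ^ r) ?_)
  filter_upwards [eventually_gt_atTop k] with n hn
  have hn0 : (0 : ℝ) < n := Nat.cast_pos.2 (by lia)
  have hle : ((n + k : ℕ) : ℝ) ≤ 2 * n := by exact_mod_cast (by lia)
  have hk0 : (0 : ℝ) < (n + k : ℕ) := Nat.cast_pos.2 (by lia)
  rw [Real.norm_of_nonneg (Real.rpow_nonneg hn0.le _),
    Real.norm_of_nonneg (Real.rpow_nonneg hk0.le _)]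
  calc (n : ℝ) ^ (-r) = 2 ^ r * (2 * n : ℝ) ^ (-r) := by
        rw [Real.mul_rpow two_pos.le hn0.le, ← mul_assoc, ← Real.rpow_add two_pos,
          add_neg_cancel, Real.rpow_zero, one_mul]
    _ ≤ 2 ^ r * ((n + k : ℕ) : ℝ) ^ (-r) := mul_le_mul_of_nonneg_left
        (Real.rpow_le_rpow_of_nonpos hk0 hle (neg_nonpos.2 hr)) (by positivity)

namespace IsKLDescent

variable {X : ℕ → V} {xbar : V} {e : ℕ → ℝ} {a C θ : ℝ}

lemma energy_pos_or_eventually_eq (hd : IsKLDescent X xbar e a C θ) :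
    (∀ n, 0 < e n) ∨ (fun n => X n - xbar) =ᶠ[atTop] 0 := by
  refine or_iff_not_imp_left.2 fun hpos => ?_
  push Not at hpos
  obtain ⟨n, hn⟩ := hpos
  exact (hd.eventually_eq_of_energy_nonpos hn).mono fun k hk => sub_eq_zero.2 hk

theorem exists_isBigO_pow (hd : IsKLDescent X xbar e a C θ) (hθ : θ ≤ 1 / 2) :
    ∃ ρ : ℝ, 0 < ρ ∧ ρ < 1 ∧ (fun n => X n - xbar) =O[atTop] fun n => ρ ^ n := by
  obtain hpos | heq := hd.energy_pos_or_eventually_eq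
  · obtain ⟨ρ, hρ0, hρ1, hO⟩ := hd.exists_isBigO_pow_of_energy_pos hθ hpos
    exact ⟨ρ, hρ0, hρ1, isBigO_pow_of_shift hρ0.ne' hO⟩
  · exact ⟨1 / 2, by norm_num, by norm_num, heq.trans_isBigO (Asymptotics.isBigO_zero _ _)⟩

theorem isBigO_rpow (hd : IsKLDescent X xbar e a C θ) (hθ0 : 1 / 2 < θ) (hθ1 : θ < 1) :
    (fun n => X n - xbar) =O[atTop] fun n : ℕ => (n : ℝ) ^ (-((1 - θ) / (2 * θ - 1))) := by
  obtain hpos | heq := hd.energy_pos_or_eventually_eq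
  · have hr : 0 ≤ (1 - θ) / (2 * θ - 1) := div_nonneg (by linarith) (by linarith)
    refine isBigO_rpow_neg_of_shift hr (k := 2) (.trans ?_ (hd.energy_rpow_isBigO hθ0 hθ1 hpos))
    refine Asymptotics.IsBigO.of_bound (1 / √a + C / ((1 - θ) * a))
      (Eventually.of_forall fun n => ?_)
    rw [Real.norm_of_nonneg (Real.rpow_nonneg (hpos n).le _)]
    exact hd.norm_sub_le_energy_rpow hθ0.le hθ1 hpos n
  · exact heq.trans_isBigO (Asymptotics.isBigO_zero _ _)

end IsKLDescent

end Rates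

section Convergence

variable {f h : Euc N → EReal} {m : Euc N → Euc N → EReal} {Lu Ll : ℝ}

lemma IsModelBPG.iterate_mem (hm : ModelAssumption f h m Lu Ll) {τlo τhi : ℝ} {τ : ℕ → ℝ}
    {x : ℕ → Euc N} (halg : IsModelBPG f h m Lu τlo τhi τ x) (k : ℕ) :
    x k ∈ edom f ∩ interior (edom h) := by
  induction k with
  | zero => exact halg.init_mem
  | succ k ih =>
    obtain rfl | hk := k.eq_zero_or_pos
    · exact halg.init_eq ▸ halg.init_mem
    · exact mem_of_isMinOn_step hm (halg.τlo_pos.trans_le (halg.step_mem k hk).1) ih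
        (halg.update k hk)

lemma IsModelBPG.one_div_sub_pos (hm : ModelAssumption f h m Lu Ll) {τlo τhi : ℝ} {τ : ℕ → ℝ}
    {x : ℕ → Euc N} (halg : IsModelBPG f h m Lu τlo τhi τ x) : 0 < 1 / τhi - Lu :=
  sub_pos.2 ((lt_one_div (halg.τlo_pos.trans halg.τlo_lt) hm.Lu_pos).1 halg.τhi_lt)

lemma tendsto_toLp_succ {x : ℕ → Euc N} {xbar : Euc N} (hlim : Tendsto x atTop (𝓝 xbar)) :
    Tendsto (fun k => (WithLp.toLp 2 (x (k + 1), x k) : Euc2 N)) atTop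
      (𝓝 (WithLp.toLp 2 (xbar, xbar))) := by
  have hpair : Continuous fun z : Euc N × Euc N => (WithLp.toLp 2 z : Euc2 N) := by fun_prop
  exact (hpair.tendsto (xbar, xbar)).comp
    (((tendsto_add_atTop_iff_nat 1).2 hlim).prodMk_nhds hlim)

lemma tendsto_lyapunovReal (hm : ModelAssumption f h m Lu Ll) {x : ℕ → Euc N} {xbar : Euc N}
    (hx : ∀ k, x k ∈ edom f) (hxbar : xbar ∈ edom f ∩ interior (edom h))
    (hlim : Tendsto x atTop (𝓝 xbar)) :
    Tendsto (fun k => lyapunovReal h m Lu (x (k + 1)) (x k)) atTop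
      (𝓝 (lyapunovReal h m Lu xbar xbar)) := by
  have hpair := tendsto_toLp_succ hlim
  have hmodel : Tendsto (fun k => (m (x (k + 1)) (x k)).toReal) atTop
      (𝓝 (m xbar xbar).toReal) :=
    (EReal.tendsto_toReal (hm.model_lt_top hxbar.1 hxbar.1).ne (hm.model_ne_bot _ _)).comp
      ((hm.joint_cont (WithLp.toLp 2 (xbar, xbar)) ⟨hxbar.1, hxbar.1⟩).tendsto.comp
        (tendsto_nhdsWithin_iff.2 ⟨hpair, Eventually.of_forall fun k => ⟨hx _, hx _⟩⟩))
  have hbregman : ContinuousAt (fun z : Euc2 N => bregmanReal h z.fst z.snd)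
      (WithLp.toLp 2 (xbar, xbar)) :=
    (hasGradientAt_bregmanReal (z := WithLp.toLp 2 (xbar, xbar)) hm.legendre hm.contDiffOn
      hxbar.2 hxbar.2).continuousAt
  exact hmodel.add ((hbregman.tendsto.comp hpair).const_mul Lu)

lemma exists_eventually_lyapunovReal_add_le (hf : IsProper f) (hm : ModelAssumption f h m Lu Ll)
    (hsc : LocalStrongConvexity h) {τlo τhi : ℝ} {τ : ℕ → ℝ} {x : ℕ → Euc N}
    (halg : IsModelBPG f h m Lu τlo τhi τ x) {xbar : Euc N} (hxbar : xbar ∈ interior (edom h))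
    (hlim : Tendsto x atTop (𝓝 xbar)) :
    ∃ a > 0, ∀ᶠ k in atTop,
      lyapunovReal h m Lu (x (k + 2)) (x (k + 1)) + a * ‖x (k + 2) - x (k + 1)‖ ^ 2 ≤
        lyapunovReal h m Lu (x (k + 1)) (x k) := by
  have hx := halg.iterate_mem hm
  have hgap := halg.one_div_sub_pos hm
  obtain ⟨ρ, hρ, hball⟩ := Metric.nhds_basis_closedBall.mem_iff.1 (isOpen_interior.mem_nhds hxbar)
  obtain ⟨σ, hσ, hstrong⟩ := hsc (Metric.closedBall xbar ρ) hball (isCompact_closedBall _ _)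
    (convex_closedBall _ _)
  have hnear := hlim.eventually (Metric.closedBall_mem_nhds xbar hρ)
  refine ⟨(1 / τhi - Lu) * (σ / 2), by positivity, ?_⟩
  filter_upwards [(tendsto_add_atTop_nat 1).eventually hnear,
    (tendsto_add_atTop_nat 2).eventually hnear] with k hk1 hk2
  have hτ := halg.step_mem (k + 1) k.succ_pos
  have hdecrease := lyapunovReal_add_le_of_isMinOn_step hf hm (halg.τlo_pos.trans_le hτ.1) hτ.2
    (hx k) (hx (k + 1)) (hx (k + 2)) (halg.update (k + 1) k.succ_pos)
  have hquadratic := hstrong _ hk2 _ hk1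
  rw [bregman_eq_coe hm.legendre (interior_subset (hx _).2) (hx _).2, EReal.coe_le_coe_iff]
    at hquadratic
  linarith [mul_le_mul_of_nonneg_left hquadratic hgap.le]

lemma rpow_le_of_one_le_ofReal_deriv_mul {c θ s d : ℝ} {S : ENNReal} (hc : 0 ≤ c) (hθ : θ ≤ 1)
    (hs : 0 < s) (hS : S ≤ ENNReal.ofReal d)
    (hKL : 1 ≤ ENNReal.ofReal (deriv (fun t : ℝ => c * t ^ (1 - θ)) s) * S) :
    s ^ θ ≤ c * (1 - θ) * d := by
  have hderiv : deriv (fun t : ℝ => c * t ^ (1 - θ)) s = c * (1 - θ) / s ^ θ := by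
    rw [((Real.hasDerivAt_rpow_const (.inl hs.ne')).const_mul c).deriv, sub_sub_cancel_left,
      Real.rpow_neg hs.le, ← mul_assoc, div_eq_mul_inv]
  have hsθ : 0 < s ^ θ := Real.rpow_pos_of_pos hs θ
  have hderiv_nonneg : 0 ≤ c * (1 - θ) / s ^ θ :=
    div_nonneg (mul_nonneg hc (sub_nonneg.2 hθ)) hsθ.le
  have hle : 1 ≤ ENNReal.ofReal (c * (1 - θ) / s ^ θ * d) := by
    rw [ENNReal.ofReal_mul hderiv_nonneg, ← hderiv]
    exact hKL.trans (mul_le_mul_right hS _)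
  rwa [ENNReal.one_le_ofReal, div_mul_eq_mul_div, one_le_div hsθ] at hle

lemma exists_eventually_rpow_lyapunovReal_sub_le (hm : ModelAssumption f h m Lu Ll)
    (hrel : RelativeErrorAssumption f m) {τlo τhi : ℝ} {τ : ℕ → ℝ} {x : ℕ → Euc N}
    (halg : IsModelBPG f h m Lu τlo τhi τ x) {xbar : Euc N}
    (hxbar : xbar ∈ edom f ∩ interior (edom h)) (hlim : Tendsto x atTop (𝓝 xbar)) {c θ : ℝ}
    (hc : 0 < c) (hθ : θ < 1)
    (hKL : HasKLPropertyAt (lyapunov h m Lu) (WithLp.toLp 2 (xbar, xbar))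
      (fun s : ℝ => c * s ^ (1 - θ))) :
    ∃ C > 0, ∀ᶠ k in atTop,
      lyapunovReal h m Lu xbar xbar < lyapunovReal h m Lu (x (k + 1)) (x k) →
      (lyapunovReal h m Lu (x (k + 1)) (x k) - lyapunovReal h m Lu xbar xbar) ^ θ ≤
        C * ‖x (k + 1) - x k‖ := by
  have hx := halg.iterate_mem hm
  have hxh (k : ℕ) : x k ∈ edom f ∩ edom h := ⟨(hx k).1, interior_subset (hx k).2⟩
  have hFbar := lyapunov_eq_coe hm ⟨hxbar.1, interior_subset hxbar.2⟩ hxbar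
  obtain ⟨ρ, b, hρ, hb, hbound⟩ := exists_subdiffNorm_lyapunov_le hm hrel hxbar.2 halg.τlo_pos
  obtain ⟨η, hη, -, U, hU, hKLU⟩ := hKL
  have : 0 < 1 - θ := sub_pos.2 hθ
  have hbelow : ∀ᶠ k in atTop, (lyapunovReal h m Lu (x (k + 1)) (x k) : EReal) <
      lyapunovReal h m Lu xbar xbar + η :=
    ((continuous_coe_real_ereal.tendsto _).comp
      (tendsto_lyapunovReal hm (fun k => (hx k).1) hxbar hlim)).eventually
      (gt_mem_nhds (by simpa using EReal.add_lt_add_left_coe hη (lyapunovReal h m Lu xbar xbar)))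
  have hnear := hlim.eventually (Metric.ball_mem_nhds xbar hρ)
  refine ⟨c * (1 - θ) * b, by positivity, ?_⟩
  filter_upwards [hnear, (tendsto_add_atTop_nat 1).eventually hnear,
    (tendsto_toLp_succ hlim).eventually hU, hbelow, eventually_ge_atTop 1]
    with k hk hk1 hkU hkη hk0 hlt
  have hF := lyapunov_eq_coe hm (hxh (k + 1)) (hx k)
  have hsubdiff := hbound _ ⟨(hx _).1, hk1⟩ _ ⟨(hx k).1, hk⟩ _ (halg.step_mem k hk0).1
    (halg.update k hk0)
  have hineq := hKLU _ hkU (by rwa [hFbar, hF, EReal.coe_lt_coe_iff]) (by rwa [hFbar, hF])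
  rw [hFbar, hF, EReal.toReal_coe, EReal.toReal_coe] at hineq
  rw [mul_assoc _ b]
  exact rpow_le_of_one_le_ofReal_deriv_mul hc.le hθ.le (sub_pos.2 hlt) hsubdiff hineq

theorem exists_isKLDescent (hf : IsProper f) (hm : ModelAssumption f h m Lu Ll)
    (hrel : RelativeErrorAssumption f m) (hsc : LocalStrongConvexity h) {τlo τhi : ℝ}
    {τ : ℕ → ℝ} {x : ℕ → Euc N} (halg : IsModelBPG f h m Lu τlo τhi τ x) {xbar : Euc N}
    (hxbar : xbar ∈ edom f ∩ interior (edom h)) (hlim : Tendsto x atTop (𝓝 xbar)) {c θ : ℝ}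
    (hc : 0 < c) (hθ : θ < 1)
    (hKL : HasKLPropertyAt (lyapunov h m Lu) (WithLp.toLp 2 (xbar, xbar))
      (fun s : ℝ => c * s ^ (1 - θ))) :
    ∃ (k : ℕ) (e : ℕ → ℝ) (a C : ℝ), IsKLDescent (fun n => x (n + k)) xbar e a C θ := by
  obtain ⟨a, ha, hdecrease⟩ :=
    exists_eventually_lyapunovReal_add_le hf hm hsc halg hxbar.2 hlim
  obtain ⟨C, hC, hkl⟩ :=
    exists_eventually_rpow_lyapunovReal_sub_le hm hrel halg hxbar hlim hc hθ hKL
  set E : ℕ → ℝ := fun k =>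
    lyapunovReal h m Lu (x (k + 1)) (x k) - lyapunovReal h m Lu xbar xbar
  have hE : Tendsto E atTop (𝓝 0) := by
    simpa using (tendsto_lyapunovReal hm (fun k => (halg.iterate_mem hm k).1) hxbar
      hlim).sub_const (lyapunovReal h m Lu xbar xbar)
  obtain ⟨k, hk⟩ := eventually_atTop.1
    ((hE.eventually (ge_mem_nhds one_pos)).and (hdecrease.and hkl))
  have htail (n : ℕ) := hk (n + k) (Nat.le_add_left k n)
  refine ⟨k, fun n => E (n + k), a, C, ha, hC, (tendsto_add_atTop_iff_nat k).2 hlim,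
    (tendsto_add_atTop_iff_nat k).2 hE, fun n => (htail n).1, fun n => ?_, fun n hpos => ?_⟩
  · have hstep := (htail n).2.1
    simp only [E, Nat.add_right_comm n _ k]
    linarith
  · simp only [Nat.add_right_comm n _ k]
    exact (htail n).2.2 (sub_pos.1 hpos)

end Convergence

end ModelBPG

end

theorem mainTheorem3_general {N : ℕ} (f h : ModelBPG.Euc N → EReal)
    (m : ModelBPG.Euc N → ModelBPG.Euc N → EReal) (Lu Ll : ℝ)
    (hf : ModelBPG.IsProper f)
    (hm : ModelBPG.ModelAssumption f h m Lu Ll)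
    (hrel : ModelBPG.RelativeErrorAssumption f m)
    (hsc : ModelBPG.LocalStrongConvexity h)
    (τlo τhi : ℝ) (τ : ℕ → ℝ) (x : ℕ → ModelBPG.Euc N)
    (halg : ModelBPG.IsModelBPG f h m Lu τlo τhi τ x)
    (xbar : ModelBPG.Euc N) (hxbar : xbar ∈ ModelBPG.edom f ∩ interior (ModelBPG.edom h))
    (hlim : Filter.Tendsto x Filter.atTop (nhds xbar))
    (c θ : ℝ) (hc : 0 < c) (hθ1 : θ < 1)
    (hKL : ModelBPG.HasKLPropertyAt (ModelBPG.lyapunov h m Lu) (WithLp.toLp 2 (xbar, xbar))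
      (fun s : ℝ => c * s ^ (1 - θ))) :
    (θ = 0 → ∃ K : ℕ, ∀ k, K ≤ k → x k = xbar) ∧
    (0 < θ → θ ≤ 1 / 2 → ∃ ρ G : ℝ, 0 ≤ ρ ∧ ρ < 1 ∧ 0 < G ∧ ∀ k : ℕ, ‖x k - xbar‖ ≤ G * ρ ^ k) ∧
    (1 / 2 < θ → ∃ G : ℝ, 0 < G ∧ ∀ k : ℕ, 1 ≤ k →
      ‖x k - xbar‖ ≤ G * (k : ℝ) ^ (-((1 - θ) / (2 * θ - 1)))) := by
  obtain ⟨K, e, a, C, hd⟩ := ModelBPG.exists_isKLDescent hf hm hrel hsc halg hxbar hlim hc hθ1 hKL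
  refine ⟨?_, fun _ hθ => ?_, fun hθ => ?_⟩
  · rintro rfl
    refine eventually_atTop.1 ?_
    rw [← map_add_atTop_eq_nat K]
    exact hd.eventually_eq_of_exponent_zero
  · obtain ⟨ρ, hρ0, hρ1, hO⟩ := hd.exists_isBigO_pow hθ
    obtain ⟨G, hG, hle⟩ := Asymptotics.bound_of_isBigO_nat_atTop
      (ModelBPG.isBigO_pow_of_shift (u := fun k => x k - xbar) hρ0.ne' hO)
    refine ⟨ρ, G, hρ0.le, hρ1, hG, fun k => ?_⟩
    simpa only [Real.norm_of_nonneg (pow_pos hρ0 k).le] using hle (pow_pos hρ0 k).ne'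
  · have hr : 0 ≤ (1 - θ) / (2 * θ - 1) := div_nonneg (by linarith) (by linarith)
    obtain ⟨G, hG, hle⟩ := Asymptotics.bound_of_isBigO_nat_atTop
      (ModelBPG.isBigO_rpow_neg_of_shift (u := fun k => x k - xbar) hr (hd.isBigO_rpow hθ hθ1))
    refine ⟨G, hG, fun k hk => ?_⟩
    have hpos := Real.rpow_pos_of_pos (Nat.cast_pos (α := ℝ).2 hk) (-((1 - θ) / (2 * θ - 1)))
    simpa only [Real.norm_of_nonneg hpos.le] using hle hpos.ne'

theorem mainTheorem3 {N : ℕ} (f h : ModelBPG.Euc N → EReal)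
    (m : ModelBPG.Euc N → ModelBPG.Euc N → EReal) (Lu Ll : ℝ)
    (hf : ModelBPG.ObjectiveAssumption f)
    (hm : ModelBPG.ModelAssumption f h m Lu Ll)
    (hrel : ModelBPG.RelativeErrorAssumption f m)
    (hsc : ModelBPG.LocalStrongConvexity h)
    (τlo τhi : ℝ) (τ : ℕ → ℝ) (x : ℕ → ModelBPG.Euc N)
    (halg : ModelBPG.IsModelBPG f h m Lu τlo τhi τ x)
    (xbar : ModelBPG.Euc N) (hxbar : xbar ∈ ModelBPG.edom f ∩ interior (ModelBPG.edom h))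
    (hlim : Filter.Tendsto x Filter.atTop (nhds xbar))
    (c θ : ℝ) (hc : 0 < c) (hθ0 : 0 ≤ θ) (hθ1 : θ < 1)
    (hKL : ModelBPG.HasKLPropertyAt (ModelBPG.lyapunov h m Lu) (WithLp.toLp 2 (xbar, xbar))
      (fun s : ℝ => c * s ^ (1 - θ))) :
    (θ = 0 → ∃ K : ℕ, ∀ k, K ≤ k → x k = xbar) ∧
    (0 < θ → θ ≤ 1 / 2 → ∃ ρ G : ℝ, 0 ≤ ρ ∧ ρ < 1 ∧ 0 < G ∧ ∀ k : ℕ, ‖x k - xbar‖ ≤ G * ρ ^ k) ∧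
    (1 / 2 < θ → ∃ G : ℝ, 0 < G ∧ ∀ k : ℕ, 1 ≤ k →
      ‖x k - xbar‖ ≤ G * (k : ℝ) ^ (-((1 - θ) / (2 * θ - 1)))) :=
  mainTheorem3_general f h m Lu Ll hf.proper hm hrel hsc τlo τhi τ x halg xbar hxbar hlim c θ hc hθ1
    hKL
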